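/- Let $\Gamma$ be a finite connected graph (self-loops and multiple edges are allowed) with edge set $E$, $|E|=n$. A set $S\subseteq E$ is a spanning tree if the subgraph formed by all vertices of $\Gamma$ and the edges in $S$ is a tree. A set $C\subseteq E$ is a cut if removing the edges of $C$ from $\Gamma$ leaves a disconnected union of trees, and adding any edge of $C$ back to the remaining graph creates a loop (closed path) or makes it connected. Consider the first Symanzik polynomial and the second Symanzik polynomial with mass terms $$\Psi_\Gamma=\sum_{S\ \text{spanning tree}}\ \prod_{e\notin S}t_e,\qquad Q_\Gamma=\sum_{C\ \text{cut}}P_C\prod_{e\in C}t_e+\Big(\sum_{e\in E}m_e^2t_e\Big)\Psi_\Gamma ,$$ as polynomials in the variables $t_e$ $(e\in E)$, where the momentum variables $P_C$ and the masses $m_e$ are independent indeterminates. Let $A\subset\mathbb{Z}^{n+1}$ be the finite set of the points $(1,T)$, where $T\in\mathbb{Z}_{\ge 0}^{E}$ is the exponent vector of a monomial $t^T$ that appears in $\Psi_\Gamma$ or in $Q_\Gamma$, and let $\Sigma\subset\mathbb{Z}^{n+1}$ be the semigroup generated by $A$ and $0$. Then $\Sigma$ is saturated: every point of $\mathbb{Z}^{n+1}$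 that lies in the cone in $\mathbb{R}^{n+1}$ generated by $\Sigma$ belongs to $\Sigma$. Consequently, for every field $k$, the projective toric variety $\mathbb{P}_\Sigma=\operatorname{Proj}k[\Sigma]$ (graded by the first coordinate) is projectively normal, i.e. the semigroup algebra $k[\Sigma]$ is an integrally closed domain; and the toric ideal $I_A=\ker\big(k[x_a:a\in A]\to k[\mathbb{Z}^{n+1}],\ x_a\mapsto t^a\big)$ is Cohen–Macaulay, i.e. $k[x_a:a\in A]/I_A$ is a Cohen–Macaulay ring. -/

import Mathlib

open scoped Graph

noncomputable section

namespace Feynman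

/-! ### Graphs (finite multigraphs; self-loops and multiple edges are allowed) -/

/-- A nonempty graph any two of whose vertices are joined by a sequence of edges. -/
def IsConnected {α β : Type*} (G : Graph α β) : Prop :=
  V(G).Nonempty ∧ ∀ x ∈ V(G), ∀ y ∈ V(G), Relation.ReflTransGen G.Adj x y

/-- The graph contains a loop, i.e. a closed path with `k + 1 ≥ 1` distinct vertices
`v 0, …, v k` and distinct edges `e 0, …, e k`, where `e i` joins `v i` to `v (i + 1)` and the
indices are taken cyclically (so `k = 0` is a self-loop and `k = 1` a pair of parallel edges). -/
def HasLoop {α β : Type*} (G : Graph α β) : Prop :=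
  ∃ (k : ℕ) (v : Fin (k + 1) → α) (e : Fin (k + 1) → β),
    Function.Injective v ∧ Function.Injective e ∧ ∀ i, G.IsLink (e i) (v i) (v (i + 1))

/-- `S` is (the edge set of) a spanning tree: the subgraph formed by all vertices and by the edges
in `S` is a tree. -/
def IsSpanningTree {α β : Type*} (G : Graph α β) (S : Finset E(G)) : Prop :=
  IsConnected (G.restrict (Subtype.val '' (S : Set E(G)))) ∧
    ¬ HasLoop (G.restrict (Subtype.val '' (S : Set E(G))))

/-- `C` is a cut: removing its edges leaves a disconnected union of trees, and adding back any edge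
of `C` either creates a loop or makes the graph connected. -/
def IsCut {α β : Type*} (G : Graph α β) (C : Finset E(G)) : Prop :=
  (¬ IsConnected (G.deleteEdges (Subtype.val '' (C : Set E(G)))) ∧
    ¬ HasLoop (G.deleteEdges (Subtype.val '' (C : Set E(G))))) ∧
  ∀ e ∈ C,
    HasLoop (G.deleteEdges (Subtype.val '' ((C : Set E(G)) \ {e}))) ∨
      IsConnected (G.deleteEdges (Subtype.val '' ((C : Set E(G)) \ {e})))

open scoped Classical in
/-- The set `Span` of spanning trees. -/
def spanningTrees {α β : Type*} (G : Graph α β) [Fintype E(G)] : Finset (Finset E(G)) :=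
  {S | IsSpanningTree G S}

open scoped Classical in
/-- The set `Cut` of cuts. -/
def cuts {α β : Type*} (G : Graph α β) [Fintype E(G)] : Finset (Finset E(G)) :=
  {C | IsCut G C}

/-! ### The Symanzik polynomials

They are polynomials in the edge variables `t_e` with coefficients in the polynomial ring
`ℤ[P_C, m_e]`, so that the momentum variables and the masses are generic. -/

/-- The ring `ℤ[P_C, m_e]`; the variables `P_C` are indexed by sets of edges (only those with `C` a
cut are used) and the variables `m_e` by edges. -/
abbrev Coeff {α β : Type*} (G : Graph α β) : Type _ :=
  MvPolynomial (Finset E(G) ⊕ E(G)) ℤ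

/-- The momentum variable `P_C`. -/
def momentumVar {α β : Type*} (G : Graph α β) (C : Finset E(G)) : Coeff G :=
  MvPolynomial.X (Sum.inl C)

/-- The mass variable `m_e`. -/
def massVar {α β : Type*} (G : Graph α β) (e : E(G)) : Coeff G :=
  MvPolynomial.X (Sum.inr e)

open scoped Classical in
/-- The first Symanzik polynomial `Ψ = ∑_{S ∈ Span} ∏_{e ∉ S} t_e`. -/
def firstSymanzik {α β : Type*} (G : Graph α β) [Fintype E(G)] :
    MvPolynomial E(G) (Coeff G) :=
  ∑ S ∈ spanningTrees G, ∏ e ∈ Sᶜ, MvPolynomial.X e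

/-- The second Symanzik polynomial including mass terms,
`Q = ∑_{C ∈ Cut} P_C ∏_{e ∈ C} t_e + (∑_e m_e² t_e) Ψ`. -/
def secondSymanzik {α β : Type*} (G : Graph α β) [Fintype E(G)] :
    MvPolynomial E(G) (Coeff G) :=
  ∑ C ∈ cuts G, MvPolynomial.C (momentumVar G C) * ∏ e ∈ C, MvPolynomial.X e +
    (∑ e, MvPolynomial.C (massVar G e ^ 2) * MvPolynomial.X e) * firstSymanzik G

/-! ### Lattice points and the semigroup

With `n` the number of edges, `Option E(G) → ℤ` is the lattice `ℤ^{n+1}`: the coordinate `none` is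
the `0`-th one, the coordinate `some e` belongs to the edge `e`. -/

/-- The lattice point `(1, T)` of a monomial `t^T`. -/
def latticePoint {ι : Type*} (T : ι →₀ ℕ) : Option ι → ℤ :=
  fun i => i.elim 1 (fun e => (T e : ℤ))

/-- The set `A ⊆ ℤ^{n+1}` of the points `(1, T)` with `t^T` a monomial of the first or of the second
Symanzik polynomial. -/
def pointSet {α β : Type*} (G : Graph α β) [Fintype E(G)] : Set (Option E(G) → ℤ) :=
  {a | ∃ T, (T ∈ (firstSymanzik G).support ∨ T ∈ (secondSymanzik G).support) ∧
    a = latticePoint T}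

/-- The semigroup `Σ` generated by `A` and `0`. -/
def semigroup {α β : Type*} (G : Graph α β) [Fintype E(G)] : AddSubmonoid (Option E(G) → ℤ) :=
  AddSubmonoid.closure (pointSet G)

/-- A semigroup `M ⊆ ℤ^ι` is saturated if it contains every lattice point of the real cone that it
generates in `ℝ^ι`. -/
def IsSaturated {ι : Type*} (M : AddSubmonoid (ι → ℤ)) : Prop :=
  ∀ z : ι → ℤ,
    (fun i => (z i : ℝ)) ∈ PointedCone.hull ℝ ((fun (a : ι → ℤ) i => (a i : ℝ)) '' (M : Set (ι → ℤ))) →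
      z ∈ M

/-! ### The toric ideal and the Cohen–Macaulay property -/

/-- The toric ideal `I_A ⊆ k[x_a : a ∈ A]` of a set `A` of lattice points: the kernel of the
homomorphism to the group algebra `k[ℤ^ι]` which maps `x_a` to `t^a`. -/
def toricIdeal (k : Type*) [Field k] {ι : Type*} (A : Set (ι → ℤ)) : Ideal (MvPolynomial A k) :=
  RingHom.ker (MvPolynomial.aeval (R := k)
    (fun a : A => (AddMonoidAlgebra.single (a : ι → ℤ) 1 : AddMonoidAlgebra k (ι → ℤ))))

/-- A local ring has depth equal to its dimension: its maximal ideal contains a regular sequence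
whose length is the Krull dimension. -/
def IsCohenMacaulayLocal (R : Type*) [CommRing R] [IsLocalRing R] : Prop :=
  ∃ rs : List R, (∀ r ∈ rs, r ∈ IsLocalRing.maximalIdeal R) ∧
    RingTheory.Sequence.IsRegular R rs ∧ (rs.length : WithBot ℕ∞) = ringKrullDim R

/-- A Cohen–Macaulay ring: a Noetherian ring all of whose localizations at maximal ideals are
Cohen–Macaulay local rings. -/
def IsCohenMacaulayRing (R : Type*) [CommRing R] : Prop :=
  IsNoetherianRing R ∧
    ∀ (m : Ideal R) [m.IsMaximal], IsCohenMacaulayLocal (Localization.AtPrime m)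

end Feynman

end

/-!
The exponents of the two Symanzik polynomials are described by the graphic matroid of `G`,
represented over the field of two elements by sending an edge to the sum of its ends
(`edgeVector`). A set of edges contains a loop exactly if it is dependent (`hasLoop_iff`), and it
connects the graph exactly if it spans (`isConnected_edgeSubgraph_iff`), so the spanning trees are
the bases. Every cut arises from the complement of a spanning tree by adding one edge, and the mass
terms contain all such products. Hence `A` consists of the points `(1, T)` and `(1, T + e_f)`, where
`T` is the indicator function of the complement of a basis and `f` is an arbitrary edge
(`pointSet_eq_basisPoints`).

For every matroid, the semigroup generated by these points is the set of *all* integral solutions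
`(d, T)` of the linear inequalities `d ≥ 0`, `T(F) ≥ d (|F| - r(F))` and `T(E) ≤ d (|E| - r(E) + 1)`
(`closure_basisPoints`). By the covering theorem for matroids (`exists_covering`), the inequalities
for the sets `F` yield `d` bases whose complements have a total of at most `T`; by the remaining
inequality the difference consists of at most `d` edges, and each of the `d` points absorbs one of
them. In particular the semigroup is saturated.

The other assertions hold for the algebra of the lattice points of any rational cone defined by
inequalities `c j ≥ 0` that are strict at some point. It is integrally closed in the ring of Laurent
polynomials, because the lowest degree of an integral element with respect to `c j` cannot be
negative (`nonneg_of_isIntegral`), and the Laurent polynomials are a localization of a polynomial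
ring.

The Cohen–Macaulay property is Hochster's theorem. At a maximal ideal `m`, inverting a monomial
reduces to the case where `m` contains all noninvertible monomials
(`exists_isRegular_localization`). By the Rees theorem a regular sequence of length `n`, the rank of
the lattice, exists in `m` once `Ext^i(R / m, R) = 0` for `i < n`. This is proved more generally, in
`depthOn_of_cell`, for the modules spanned by the monomials whose exponents are the lattice points
of `v + H_ℝ` that satisfy `c j ≥ c j(v)`, where `H` is a subgroup and `v` is a point generic relative
to `H`; the bound for `i` is the rank of `H`. A noninvertible monomial `t^x` with `x ∈ H` acts
injectively on such a module. When `v` moves to `v + x`, the walls cross lattice points one after the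
other, by genericity, and each crossing removes a module of the same kind for a subgroup of corank
one (`cell_sdiff_cell`, `depthOn_sweep`); so the cokernel has depth at least `rank H - 1`. If there
is no such monomial, then the monomials with exponents in `H` are invertible, and polynomials in them
that lie in `m` form a regular sequence (`depthGE_of_units`). Finally, `n` is an upper bound for the
dimension by Noether normalization (`ringKrullDim_le_card`).
-/

namespace Feynman

universe u v

open CategoryTheory Abelian AddMonoidAlgebra

/-! ### Depth as vanishing of Ext -/

section Depth

variable {R : Type u} [CommRing R]

/-- The depth of `M` with respect to `N` is at least `e`: the modules `Ext^i(N, M)` vanish for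
`i < e`. -/
def DepthGE (N M : ModuleCat.{u} R) (e : ℕ) : Prop :=
  ∀ i < e, Subsingleton (Ext N M i)

lemma shortExact_of_exact {A B C : Type u} [AddCommGroup A] [Module R A] [AddCommGroup B]
    [Module R B] [AddCommGroup C] [Module R C] (f : A →ₗ[R] B) (g : B →ₗ[R] C)
    (hf : Function.Injective f) (hfg : Function.Exact f g) (hg : Function.Surjective g) :
    (ShortComplex.mk (ModuleCat.ofHom f) (ModuleCat.ofHom g)
      (by ext x; exact hfg.apply_apply_eq_zero x)).ShortExact := by
  refine ShortComplex.ShortExact.mk' ?_ ?_ ?_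
  · rw [ShortComplex.ShortExact.moduleCat_exact_iff_function_exact]
    exact hfg
  · exact (ModuleCat.mono_iff_injective _).2 hf
  · exact (ModuleCat.epi_iff_surjective _).2 hg

lemma DepthGE.of_exact {A B C : Type u} [AddCommGroup A] [Module R A] [AddCommGroup B]
    [Module R B] [AddCommGroup C] [Module R C] {f : A →ₗ[R] B} {g : B →ₗ[R] C}
    (hf : Function.Injective f) (hfg : Function.Exact f g) (hg : Function.Surjective g)
    {N : ModuleCat.{u} R} {e : ℕ} (hA : DepthGE N (.of R A) e) (hC : DepthGE N (.of R C) e) :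
    DepthGE N (.of R B) e := by
  intro i hi
  have h1 := AddCommGrpCat.isZero_of_iff_subsingleton.mpr (hA i hi)
  have h2 := AddCommGrpCat.isZero_of_iff_subsingleton.mpr (hC i hi)
  exact AddCommGrpCat.subsingleton_of_isZero <| ShortComplex.Exact.isZero_of_both_zeros
    (Ext.covariant_sequence_exact₂' N (shortExact_of_exact f g hf hfg hg) i)
    (h1.eq_zero_of_src _) (h2.eq_zero_of_tgt _)

/-- Dividing by a regular element `r` that annihilates `N` lowers the depth by at most one: the
connecting map embeds `Ext^{i+1}(N, M)`, on which `r` is zero, as a quotient of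
`Ext^i(N, M / r M)`. -/
lemma DepthGE.succ_of_exact {B C : Type u} [AddCommGroup B] [Module R B]
    [AddCommGroup C] [Module R C] {r : R} {g : B →ₗ[R] C}
    (hf : Function.Injective (LinearMap.lsmul R B r))
    (hfg : Function.Exact (LinearMap.lsmul R B r) g) (hg : Function.Surjective g)
    {N : ModuleCat.{u} R} {e : ℕ} (hN : r ∈ Module.annihilator R N) (hC : DepthGE N (.of R C) e) :
    DepthGE N (.of R B) (e + 1) := by
  have hse := shortExact_of_exact _ g hf hfg hg
  have hzero (i : ℕ) : AddCommGrpCat.ofHom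
      ((Ext.mk₀ (ModuleCat.ofHom (LinearMap.lsmul R B r))).postcomp N (add_zero i)) = 0 :=
    Ext.postcomp_smul_id_eq_zero_of_mem_annihilator (M := .of R B) hN i
  have key (i : ℕ) (hm : Mono (AddCommGrpCat.ofHom
      ((Ext.mk₀ (ModuleCat.ofHom (LinearMap.lsmul R B r))).postcomp N (add_zero i)))) :
      Subsingleton (Ext N (.of R B) i) := by
    have := hm
    exact AddCommGrpCat.subsingleton_of_isZero (Limits.IsZero.of_mono_eq_zero _ (hzero i))
  intro i hi
  cases i with
  | zero =>
    apply key
    rw [AddCommGrpCat.mono_iff_injective]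
    have : Mono (ModuleCat.ofHom (LinearMap.lsmul R B r)) := (ModuleCat.mono_iff_injective _).2 hf
    exact Ext.postcomp_mk₀_injective_of_mono N _
  | succ i =>
    apply key
    have h2 := AddCommGrpCat.isZero_of_iff_subsingleton.mpr (hC i (by omega))
    exact (Ext.covariant_sequence_exact₁' N hse i (i + 1) rfl).mono_g (h2.eq_zero_of_src _)

lemma DepthGE.of_subsingleton {B : Type u} [AddCommGroup B] [Module R B] [Subsingleton B]
    (N : ModuleCat.{u} R) (e : ℕ) : DepthGE N (.of R B) e := by
  intro i _
  have h : Limits.IsZero (ModuleCat.of R B) := ModuleCat.isZero_of_subsingleton _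
  refine ⟨fun a b => ?_⟩
  rw [← Ext.comp_mk₀_id a, ← Ext.comp_mk₀_id b, h.eq_of_src (𝟙 _) 0]
  simp

end Depth

/-! ### Depth of subquotients -/

section Subquotient

variable {R : Type u} [CommRing R] {T : Type u} [AddCommGroup T] [Module R T]

/-- The subquotient `C / A` of a module, for submodules `A ≤ C`. -/
abbrev Subquotient (C A : Submodule R T) : Type u := C ⧸ A.submoduleOf C

lemma subquotient_subsingleton {C A : Submodule R T} (h : C ≤ A) :
    Subsingleton (Subquotient C A) := by
  rw [Submodule.Quotient.subsingleton_iff, Submodule.submoduleOf_eq_top]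
  exact h

/-- The depth of `C / A` is at least the minimum of those of `B / A` and `C / B`. -/
lemma DepthGE.subquotient_trans {A B C : Submodule R T} (hAB : A ≤ B) (hBC : B ≤ C)
    {N : ModuleCat.{u} R} {e : ℕ} (h1 : DepthGE N (.of R (Subquotient B A)) e)
    (h2 : DepthGE N (.of R (Subquotient C B)) e) :
    DepthGE N (.of R (Subquotient C A)) e := by
  have hf : A.submoduleOf B ≤ (A.submoduleOf C).comap (Submodule.inclusion hBC) := fun x hx => hx
  have hg : A.submoduleOf C ≤ (B.submoduleOf C).comap LinearMap.id := fun x hx => hAB hx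
  refine DepthGE.of_exact (f := Submodule.mapQ _ _ (Submodule.inclusion hBC) hf)
    (g := Submodule.mapQ _ _ LinearMap.id hg) ?_ ?_ ?_ h1 h2
  · rw [injective_iff_map_eq_zero]
    intro x
    obtain ⟨x, rfl⟩ := Submodule.mkQ_surjective _ x
    intro hx
    simp only [Submodule.mkQ_apply, Submodule.mapQ_apply, Submodule.Quotient.mk_eq_zero] at hx ⊢
    exact hx
  · intro y
    obtain ⟨y, rfl⟩ := Submodule.mkQ_surjective _ y
    simp only [Submodule.mkQ_apply, Submodule.mapQ_apply, Submodule.Quotient.mk_eq_zero,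
      LinearMap.id_apply]
    constructor
    · intro hy
      exact ⟨Submodule.Quotient.mk ⟨y.1, hy⟩, rfl⟩
    · rintro ⟨x, hx⟩
      obtain ⟨x, rfl⟩ := Submodule.mkQ_surjective _ x
      simp only [Submodule.mkQ_apply, Submodule.mapQ_apply] at hx
      rw [Submodule.Quotient.eq] at hx
      have h3 : ((x : T) - (y : T)) ∈ A := hx
      have h4 := B.sub_mem x.2 (hAB h3)
      rw [sub_sub_cancel] at h4
      exact h4
  · intro y
    obtain ⟨y, rfl⟩ := Submodule.mkQ_surjective _ y
    exact ⟨Submodule.Quotient.mk y, rfl⟩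

/-- If `r` annihilates `N` and is regular on `C / A`, then the depth of `C / A` exceeds that of
`C / B`, where `B = A + r C`. -/
lemma DepthGE.subquotient_succ {A B C : Submodule R T} (hAB : A ≤ B)
    {r : R} (hreg : ∀ c ∈ C, r • c ∈ A → c ∈ A) (hrB : ∀ c ∈ C, r • c ∈ B)
    (hB : ∀ b ∈ B, ∃ a ∈ A, ∃ c ∈ C, b = a + r • c)
    {N : ModuleCat.{u} R} {e : ℕ} (hN : r ∈ Module.annihilator R N)
    (h : DepthGE N (.of R (Subquotient C B)) e) :
    DepthGE N (.of R (Subquotient C A)) (e + 1) := by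
  have hg : A.submoduleOf C ≤ (B.submoduleOf C).comap LinearMap.id := fun x hx => hAB hx
  refine DepthGE.succ_of_exact (r := r) (g := Submodule.mapQ _ _ LinearMap.id hg) ?_ ?_ ?_ hN h
  · rw [injective_iff_map_eq_zero]
    intro x
    obtain ⟨x, rfl⟩ := Submodule.mkQ_surjective _ x
    intro hx
    simp only [Submodule.mkQ_apply, LinearMap.lsmul_apply, ← Submodule.Quotient.mk_smul,
      Submodule.Quotient.mk_eq_zero] at hx ⊢
    exact hreg x x.2 hx
  · intro y
    obtain ⟨y, rfl⟩ := Submodule.mkQ_surjective _ y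
    simp only [Submodule.mkQ_apply, Submodule.mapQ_apply, Submodule.Quotient.mk_eq_zero,
      LinearMap.id_apply]
    constructor
    · intro hy
      obtain ⟨a, ha, c, hc, hac⟩ := hB y hy
      refine ⟨Submodule.Quotient.mk ⟨c, hc⟩, ?_⟩
      simp only [LinearMap.lsmul_apply, ← Submodule.Quotient.mk_smul]
      rw [Submodule.Quotient.eq]
      change r • c - (y : T) ∈ A
      rw [hac, sub_add_cancel_right]
      exact A.neg_mem ha
    · rintro ⟨x, hx⟩
      obtain ⟨x, rfl⟩ := Submodule.mkQ_surjective _ x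
      simp only [Submodule.mkQ_apply, LinearMap.lsmul_apply, ← Submodule.Quotient.mk_smul] at hx
      rw [Submodule.Quotient.eq] at hx
      have h3 : (r • (x : T) - (y : T)) ∈ A := hx
      have h4 := B.sub_mem (hrB x x.2) (hAB h3)
      rw [sub_sub_cancel] at h4
      exact h4
  · intro y
    obtain ⟨y, rfl⟩ := Submodule.mkQ_surjective _ y
    exact ⟨Submodule.Quotient.mk y, rfl⟩

end Subquotient

/-! ### Monoid algebras inside the group algebra -/

section MonoidSubalgebra

variable (k : Type u) [Field k] {L : Type v} [AddCommGroup L]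

/-- The algebra of a submonoid `M` of `L`, as the subalgebra of the elements of `k[L]` supported
in `M`. -/
def monoidSubalgebra (M : AddSubmonoid L) : Subalgebra k k[L] where
  carrier := {f | ∀ z, f.coeff z ≠ 0 → z ∈ M}
  mul_mem' {f g} hf hg z hz := by
    classical
    have h := support_coeff_mul_subset f g (Finsupp.mem_support_iff.2 hz)
    obtain ⟨x, hx, y, hy, rfl⟩ := Finset.mem_add.1 h
    exact M.add_mem (hf x (Finsupp.mem_support_iff.1 hx)) (hg y (Finsupp.mem_support_iff.1 hy))
  add_mem' {f g} hf hg z hz := by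
    by_cases h : f.coeff z = 0
    · refine hg z fun h' => hz ?_
      simp [h, h']
    · exact hf z h
  algebraMap_mem' c z hz := by
    classical
    have h : z = 0 := by
      by_contra h
      apply hz
      simp [Ne.symm h]
    exact h ▸ M.zero_mem

variable {k}

lemma single_mem_monoidSubalgebra {M : AddSubmonoid L} {x : L} (hx : x ∈ M) (c : k) :
    single x c ∈ monoidSubalgebra k M := by
  classical
  intro z hz
  rw [coeff_single, Finsupp.single_apply] at hz
  split_ifs at hz with h
  · exact h ▸ hx
  · exact absurd rfl hz

variable (k) in
/-- The monomial `t^x` as an element of the algebra of `M`. -/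
noncomputable def monomialOf {M : AddSubmonoid L} (x : M) : monoidSubalgebra k M :=
  ⟨single (x : L) 1, single_mem_monoidSubalgebra x.2 1⟩

lemma monomialOf_smul_coeff {M : AddSubmonoid L} (x : M) (f : k[L]) (z : L) :
    (monomialOf k x • f).coeff z = f.coeff (z - x) := by
  change (single (x : L) (1 : k) * f).coeff z = _
  rw [coeff_single_mul_apply, one_mul, neg_add_eq_sub]

lemma monomialOf_add {M : AddSubmonoid L} (x y : M) :
    monomialOf k (x + y) = monomialOf k x * monomialOf k y := by
  apply Subtype.ext
  change single ((x : L) + y) (1 : k) = single (x : L) 1 * single (y : L) 1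
  rw [single_mul_single, one_mul]

lemma monomialOf_nsmul {M : AddSubmonoid L} (n : ℕ) (x : M) :
    monomialOf k (n • x) = monomialOf k x ^ n := by
  apply Subtype.ext
  change single (n • (x : L)) (1 : k) = single (x : L) 1 ^ n
  rw [single_pow, one_pow]

lemma monomialOf_zero {M : AddSubmonoid L} : monomialOf k (0 : M) = 1 := rfl

/-- A subset of `L` closed under translation by elements of `M`. -/
def IsStable (M : AddSubmonoid L) (U : Set L) : Prop := ∀ a ∈ M, ∀ z ∈ U, a + z ∈ U

variable (k) in
/-- The submodule of the elements of `k[L]` supported in an `M`-stable set. -/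
def supportedIn {M : AddSubmonoid L} (U : Set L) (hU : IsStable M U) :
    Submodule (monoidSubalgebra k M) k[L] where
  carrier := {f | ∀ z, f.coeff z ≠ 0 → z ∈ U}
  add_mem' {f g} hf hg z hz := by
    by_cases h : f.coeff z = 0
    · refine hg z fun h' => hz ?_
      simp [h, h']
    · exact hf z h
  zero_mem' z hz := absurd rfl hz
  smul_mem' r f hf z hz := by
    classical
    have h := support_coeff_mul_subset (r : k[L]) f (Finsupp.mem_support_iff.2 hz)
    obtain ⟨x, hx, y, hy, rfl⟩ := Finset.mem_add.1 h
    exact hU _ (r.2 x (Finsupp.mem_support_iff.1 hx)) _ (hf y (Finsupp.mem_support_iff.1 hy))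

lemma supportedIn_mono {M : AddSubmonoid L} {U V : Set L} {hU : IsStable M U}
    {hV : IsStable M V} (h : U ⊆ V) : supportedIn k U hU ≤ supportedIn k V hV :=
  fun _ hf z hz => h (hf z hz)

end MonoidSubalgebra

/-! ### Gradings of the group algebra -/

section Grading

variable {k : Type u} [Field k] {L : Type v} [AddCommGroup L]

/-- The homogeneous component of degree `d`, for the grading of `k[L]` by `l`. -/
noncomputable def component (l : L →+ ℤ) (d : ℤ) : k[L] →+ k[L] where
  toFun f := .ofCoeff (f.coeff.filter fun z => l z = d)
  map_zero' := by ext; simp [Finsupp.filter_zero]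
  map_add' f g := by ext; simp [Finsupp.filter_add]

lemma component_coeff (l : L →+ ℤ) (d : ℤ) (f : k[L]) (z : L) :
    (component l d f).coeff z = if l z = d then f.coeff z else 0 := by
  classical
  simp [component, Finsupp.filter_apply]

lemma component_smul (l : L →+ ℤ) (d : ℤ) (c : k) (f : k[L]) :
    component l d (c • f) = c • component l d f := by
  ext z
  simp [component_coeff]

lemma component_monomialOf_smul {M : AddSubmonoid L} (l : L →+ ℤ) (d : ℤ) (x : M) (f : k[L]) :
    component l d (monomialOf k x • f) = monomialOf k x • component l (d - l x) f := by
  ext z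
  simp [component_coeff, monomialOf_smul_coeff, sub_left_inj]

lemma sum_component (l : L →+ ℤ) (f : k[L]) :
    ∑ d ∈ f.coeff.support.image l, component l d f = f := by
  classical
  ext z
  simp only [coeff_sum, Finsupp.finsetSum_apply, component_coeff]
  by_cases hz : f.coeff z = 0
  · simp [hz]
  · rw [Finset.sum_eq_single (l z)]
    · simp
    · intro b _ hb
      simp [hb.symm]
    · intro h
      exact absurd (Finset.mem_image_of_mem l (Finsupp.mem_support_iff.2 hz)) h

/-- `A` is homogeneous for every grading that vanishes on `S`. -/
def IsHomogeneousOff {M : AddSubmonoid L} (S : Set L)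
    (A : Submodule (monoidSubalgebra k M) k[L]) : Prop :=
  ∀ l : L →+ ℤ, (∀ s ∈ S, l s = 0) → ∀ f ∈ A, ∀ d, component l d f ∈ A

lemma isHomogeneousOff_supportedIn {M : AddSubmonoid L} {U : Set L} (hU : IsStable M U)
    (S : Set L) : IsHomogeneousOff S (supportedIn k U hU) := by
  intro l _ f hf d z hz
  rw [component_coeff] at hz
  split_ifs at hz with h
  · exact hf z hz
  · exact absurd rfl hz

lemma aeval_monomialOf_smul {M : AddSubmonoid L} (y : M) (p : Polynomial k) (f : k[L]) :
    Polynomial.aeval (monomialOf k y) p • f =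
      ∑ r ∈ Finset.range (p.natDegree + 1), p.coeff r • (monomialOf k (r • y) • f) := by
  rw [Polynomial.aeval_eq_sum_range, Finset.sum_smul]
  refine Finset.sum_congr rfl fun r _ => ?_
  rw [monomialOf_nsmul, smul_assoc]

lemma component_aeval_smul {M : AddSubmonoid L} (y : M) (p : Polynomial k) (f : k[L])
    (l : L →+ ℤ) (d : ℤ) :
    component l d (Polynomial.aeval (monomialOf k y) p • f) =
      ∑ r ∈ Finset.range (p.natDegree + 1),
        p.coeff r • (monomialOf k (r • y) • component l (d - r * l y) f) := by
  rw [aeval_monomialOf_smul, map_sum]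
  refine Finset.sum_congr rfl fun r _ => ?_
  rw [component_smul, component_monomialOf_smul]
  simp

/-- A polynomial in an invertible monomial of nonzero degree is regular modulo every homogeneous
submodule: compare the components of highest degree that lie outside of it. -/
lemma mem_of_aeval_smul_mem {M : AddSubmonoid L} {A : Submodule (monoidSubalgebra k M) k[L]}
    {y : M} (hy : -(y : L) ∈ M) {p : Polynomial k} (hp : p ≠ 0) {l : L →+ ℤ} (hl : 0 < l y)
    (hA : ∀ f ∈ A, ∀ d, component l d f ∈ A) {f : k[L]}
    (hf : Polynomial.aeval (monomialOf k y) p • f ∈ A) : f ∈ A := by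
  obtain ⟨D, hD⟩ : ∃ D : ℤ, ∀ z, f.coeff z ≠ 0 → l z ≤ D := by
    obtain ⟨D, hD⟩ := (f.coeff.support.image l).finite_toSet.bddAbove
    exact ⟨D, fun z hz => hD (Finset.mem_coe.2
      (Finset.mem_image_of_mem l (Finsupp.mem_support_iff.2 hz)))⟩
  have key : ∀ N : ℕ, ∀ d : ℤ, D - d < N → component l d f ∈ A := by
    intro N
    induction N with
    | zero =>
      intro d hd
      have : component l d f = 0 := by
        ext z
        rw [component_coeff]
        split_ifs with h
        · by_contra hz
          have := hD z hz
          push_cast at hd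
          omega
        · rfl
      rw [this]
      exact A.zero_mem
    | succ N ih =>
      intro d hd
      have h1 := hA _ hf (d + p.natDegree * l y)
      rw [component_aeval_smul, Finset.sum_range_succ] at h1
      have h2 : ∑ r ∈ Finset.range p.natDegree, p.coeff r •
          (monomialOf k (r • y) • component l (d + p.natDegree * l y - r * l y) f) ∈ A := by
        refine A.sum_mem fun r hr => ?_
        refine A.smul_of_tower_mem _ (A.smul_mem _ (ih _ ?_))
        have h3 : (r : ℤ) + 1 ≤ p.natDegree := by exact_mod_cast Finset.mem_range.1 hr
        push_cast at hd
        nlinarith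
      have h3 := (A.add_mem_iff_right h2).1 h1
      rw [add_sub_cancel_right] at h3
      have h4 := A.smul_of_tower_mem (p.coeff p.natDegree)⁻¹ h3
      rw [smul_smul, inv_mul_cancel₀ (by simpa using hp), one_smul] at h4
      have h5 := A.smul_mem (monomialOf k (p.natDegree • (⟨-y, hy⟩ : M))) h4
      rw [smul_smul, ← monomialOf_add, ← nsmul_add] at h5
      have h6 : (⟨-(y : L), hy⟩ : M) + y = 0 := Subtype.ext (neg_add_cancel _)
      rwa [h6, nsmul_zero, monomialOf_zero, one_smul] at h5
  rw [← sum_component l f]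
  refine A.sum_mem fun d _ => key (D - d + 1).toNat d ?_
  omega

end Grading

/-! ### Depth and invertible monomials -/

section Units

variable {k : Type u} [Field k] {L : Type v} [AddCommGroup L]

/-- Suppose that the monomials `t^{y_i}` are invertible, with linearly independent exponents in
triangular position, and that polynomials `p_i(t^{y_i})` annihilate `N`. Then these polynomials form
a regular sequence on every homogeneous subquotient: dividing by the first of them preserves all
gradings in which `y_0` has degree zero, and these still detect the remaining `y_i`. -/
lemma depthGE_of_units {M : AddSubmonoid L}
    (N : ModuleCat.{max u v} (monoidSubalgebra k M)) {n : ℕ}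
    {A C : Submodule (monoidSubalgebra k M) k[L]} {S : Set L} (hAC : A ≤ C)
    (hA : IsHomogeneousOff S A) (hC : IsHomogeneousOff S C)
    (y : Fin n → M) (hy : ∀ i, -(y i : L) ∈ M) (p : Fin n → Polynomial k) (hp : ∀ i, p i ≠ 0)
    (hN : ∀ i, Polynomial.aeval (monomialOf k (y i)) (p i) ∈ Module.annihilator _ N)
    (htri : ∀ i, ∃ l : L →+ ℤ, (∀ s ∈ S, l s = 0) ∧ (∀ j < i, l (y j) = 0) ∧ 0 < l (y i)) :
    DepthGE N (.of _ (Subquotient C A)) n := by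
  induction n generalizing A S with
  | zero => intro i hi; omega
  | succ n ih =>
    set P := Polynomial.aeval (monomialOf k (y 0)) (p 0) with hP
    set B : Submodule (monoidSubalgebra k M) k[L] := A ⊔ C.map (LinearMap.lsmul _ _ P) with hBdef
    have hB : ∀ b ∈ B, ∃ a ∈ A, ∃ c ∈ C, b = a + P • c := by
      intro b hb
      obtain ⟨a, ha, _, ⟨c, hc, rfl⟩, rfl⟩ := Submodule.mem_sup.1 hb
      exact ⟨a, ha, c, hc, rfl⟩
    have hPB : ∀ c ∈ C, P • c ∈ B := fun c hc =>
      Submodule.mem_sup_right (Submodule.mem_map_of_mem (f := LinearMap.lsmul _ _ P) hc)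
    have hBC : B ≤ C := by
      intro b hb
      obtain ⟨a, ha, c, hc, rfl⟩ := hB b hb
      exact C.add_mem (hAC ha) (C.smul_mem _ hc)
    obtain ⟨l, hlS, -, hl⟩ := htri 0
    refine DepthGE.subquotient_succ (B := B) le_sup_left (r := P) ?_ hPB hB (hN 0) ?_
    · exact fun c _ hc => mem_of_aeval_smul_mem (hy 0) (hp 0) hl (hA l hlS) hc
    · refine ih (S := insert (y 0 : L) S) hBC ?_ ?_ (fun i => y i.succ) (fun i => hy _)
        (fun i => p i.succ) (fun i => hp _) (fun i => hN _) ?_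
      · intro l' hl' b hb d
        obtain ⟨a, ha, c, hc, rfl⟩ := hB b hb
        have h0 : l' (y 0) = 0 := hl' _ (Set.mem_insert _ _)
        have hS : ∀ s ∈ S, l' s = 0 := fun s hs => hl' s (Set.mem_insert_of_mem _ hs)
        rw [map_add]
        refine B.add_mem (Submodule.mem_sup_left (hA l' hS a ha d)) ?_
        have : component l' d (P • c) = P • component l' d c := by
          rw [hP, component_aeval_smul, aeval_monomialOf_smul]
          simp [h0]
        rw [this]
        exact hPB _ (hC l' hS c hc d)
      · exact fun l' hl' => hC l' fun s hs => hl' s (Set.mem_insert_of_mem _ hs)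
      · intro i
        obtain ⟨l', h1, h2, h3⟩ := htri i.succ
        refine ⟨l', ?_, fun j hj => h2 _ (Fin.succ_lt_succ_iff.2 hj), h3⟩
        rintro s (rfl | hs)
        · exact h2 0 (Fin.succ_pos i)
        · exact h1 s hs

end Units

/-! ### Generic points and cells -/

section Geometry

variable {ι : Type v}

/-- The inclusion of the lattice `ℤ^ι` in `ℝ^ι`. -/
def toReal : (ι → ℤ) →+ (ι → ℝ) where
  toFun z i := z i
  map_zero' := by ext; simp
  map_add' x y := by ext; simp

/-- The real span of a subgroup of `ℤ^ι`. -/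
def realSpan (H : Submodule ℤ (ι → ℤ)) : Submodule ℝ (ι → ℝ) :=
  Submodule.span ℝ (toReal '' (H : Set (ι → ℤ)))

lemma toReal_mem_realSpan {H : Submodule ℤ (ι → ℤ)} {h : ι → ℤ} (hh : h ∈ H) :
    toReal h ∈ realSpan H := Submodule.subset_span ⟨h, hh, rfl⟩

variable [Fintype ι]

/-- The real extension of the integral linear functional with coefficients `a`. -/
noncomputable def pairing (a : ι → ℤ) : (ι → ℝ) →ₗ[ℝ] ℝ := dotProductBilin ℝ ℝ (toReal a)

lemma pairing_apply (a : ι → ℤ) (v : ι → ℝ) : pairing a v = ∑ i, (a i : ℝ) * v i := rfl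

lemma pairing_toReal (a z : ι → ℤ) : pairing a (toReal z) = ((a ⬝ᵥ z : ℤ) : ℝ) := by
  simp [pairing_apply, toReal, dotProduct]

lemma pairing_sub_smul (a b : ι → ℤ) (m n : ℤ) (v : ι → ℝ) :
    pairing (m • a - n • b) v = m * pairing a v - n * pairing b v := by
  simp only [pairing_apply, Finset.mul_sum, ← Finset.sum_sub_distrib]
  refine Finset.sum_congr rfl fun i _ => ?_
  simp
  ring

lemma pairing_eq_zero_of_mem_realSpan {H : Submodule ℤ (ι → ℤ)} {a : ι → ℤ}
    (ha : ∀ h ∈ H, a ⬝ᵥ h = 0) {u : ι → ℝ} (hu : u ∈ realSpan H) : pairing a u = 0 := by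
  have : realSpan H ≤ LinearMap.ker (pairing a) := by
    rw [realSpan, Submodule.span_le]
    rintro _ ⟨h, hh, rfl⟩
    simp [pairing_toReal, ha h hh]
  exact this hu

/-- Rational points are dense in the real span of a lattice, so strict inequalities that have a
solution in the span have one in the lattice. -/
lemma exists_mem_forall_pos {J : Type*} [Finite J] (c : J → ι → ℤ) {H : Submodule ℤ (ι → ℤ)}
    {u : ι → ℝ} (hu : u ∈ realSpan H) :
    ∃ h ∈ H, ∀ j, 0 < pairing (c j) u → 0 < c j ⬝ᵥ h := by
  classical
  let S : Set (ι → ℝ) := {w | ∃ q : ℚ, 0 < q ∧ ∃ h ∈ H, (q : ℝ) • w = toReal h}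
  have hS0 : (0 : ι → ℝ) ∈ S := ⟨1, one_pos, 0, H.zero_mem, by simp⟩
  have hSadd : ∀ x ∈ S, ∀ y ∈ S, x + y ∈ S := by
    rintro x ⟨q, hq, h, hh, hx⟩ y ⟨q', hq', h', hh', hy⟩
    refine ⟨q.num * q'.num, by
      have := Rat.num_pos.2 hq
      have := Rat.num_pos.2 hq'
      exact_mod_cast mul_pos ‹0 < q.num› ‹0 < q'.num›,
      ((q'.num * q.den : ℤ) • h + (q.num * q'.den : ℤ) • h'),
      H.add_mem (H.smul_mem _ hh) (H.smul_mem _ hh'), ?_⟩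
    have e1 : (q.num : ℝ) = q * q.den := by exact_mod_cast (Rat.mul_den_eq_num q).symm
    have e2 : (q'.num : ℝ) = q' * q'.den := by exact_mod_cast (Rat.mul_den_eq_num q').symm
    rw [map_add, map_zsmul, map_zsmul, ← hx, ← hy]
    ext i
    simp
    rw [e1, e2]
    ring
  have hSsmul : ∀ (q : ℚ), ∀ w ∈ S, (q : ℝ) • w ∈ S := by
    rintro q w ⟨q', hq', h, hh, hw⟩
    refine ⟨q' * q.den, mul_pos hq' (by exact_mod_cast q.pos), q.num • h, H.smul_mem _ hh, ?_⟩
    have e1 : (q.num : ℝ) = q * q.den := by exact_mod_cast (Rat.mul_den_eq_num q).symm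
    rw [map_zsmul, ← hw]
    ext i
    simp
    rw [e1]
    ring
  have hcl : ∀ u ∈ realSpan H, u ∈ closure S := by
    intro u hu
    induction hu using Submodule.span_induction with
    | mem x hx =>
      obtain ⟨h, hh, rfl⟩ := hx
      exact subset_closure ⟨1, one_pos, h, hh, by simp⟩
    | zero => exact subset_closure hS0
    | add x y _ _ hx hy => exact map_mem_closure₂ continuous_add hx hy hSadd
    | smul a x _ hx =>
      refine map_mem_closure₂ (s := Set.range ((↑) : ℚ → ℝ)) continuous_smul
        (Rat.denseRange_cast a) hx ?_
      rintro _ ⟨q, rfl⟩ w hw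
      exact hSsmul q w hw
  have hopen : IsOpen {w : ι → ℝ | ∀ j, 0 < pairing (c j) u → 0 < pairing (c j) w} := by
    simp only [Set.ofPred_forall]
    refine isOpen_iInter_of_finite fun j => ?_
    by_cases hj : 0 < pairing (c j) u
    · simpa [hj] using isOpen_lt (α := ℝ) continuous_const
        (LinearMap.continuous_of_finiteDimensional (pairing (c j)))
    · simp [hj]
  obtain ⟨w, hw, q, hq, h, hh, hwh⟩ := mem_closure_iff.1 (hcl u hu) _ hopen (fun j hj => hj)
  refine ⟨h, hh, fun j hj => ?_⟩
  have := hw j hj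
  have h2 : 0 < pairing (c j) ((q : ℝ) • w) := by
    rw [map_smul, smul_eq_mul]
    exact mul_pos (by exact_mod_cast hq) this
  rw [hwh, pairing_toReal] at h2
  exact_mod_cast h2

/-- The elements of `H` on which the functional `a` vanishes. -/
def slice (H : Submodule ℤ (ι → ℤ)) (a : ι → ℤ) : Submodule ℤ (ι → ℤ) :=
  H ⊓ LinearMap.ker (dotProductBilin ℤ ℤ a)

lemma mem_slice {H : Submodule ℤ (ι → ℤ)} {a h : ι → ℤ} :
    h ∈ slice H a ↔ h ∈ H ∧ a ⬝ᵥ h = 0 := Iff.rfl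

lemma cross_mem_slice {H : Submodule ℤ (ι → ℤ)} {a x h : ι → ℤ} (hx : x ∈ H) (hh : h ∈ H) :
    (a ⬝ᵥ x) • h - (a ⬝ᵥ h) • x ∈ slice H a := by
  refine mem_slice.2 ⟨H.sub_mem (H.smul_mem _ hh) (H.smul_mem _ hx), ?_⟩
  rw [dotProduct_sub, dotProduct_smul, dotProduct_smul, smul_eq_mul, smul_eq_mul]
  ring

lemma mem_realSpan_slice {H : Submodule ℤ (ι → ℤ)} {a x : ι → ℤ} (hx : x ∈ H)
    (hax : a ⬝ᵥ x ≠ 0) {w : ι → ℝ} (hw : w ∈ realSpan H) (haw : pairing a w = 0) :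
    w ∈ realSpan (slice H a) := by
  have key : ∀ w ∈ realSpan H,
      ((a ⬝ᵥ x : ℤ) : ℝ) • w - pairing a w • toReal x ∈ realSpan (slice H a) := by
    intro w hw
    induction hw using Submodule.span_induction with
    | mem w hw =>
      obtain ⟨h, hh, rfl⟩ := hw
      have := toReal_mem_realSpan (cross_mem_slice (a := a) hx hh)
      rw [map_sub, map_zsmul, map_zsmul] at this
      rw [pairing_toReal]
      simpa only [Int.cast_smul_eq_zsmul] using this
    | zero => simp
    | add w w' _ _ h h' =>
      have := Submodule.add_mem _ h h'
      rw [map_add, add_smul, smul_add]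
      convert this using 1
      abel
    | smul r w _ h =>
      have := Submodule.smul_mem _ r h
      rw [map_smul, smul_eq_mul, mul_smul, smul_comm]
      rwa [smul_sub] at this
  have h1 := key w hw
  rw [haw, zero_smul, sub_zero] at h1
  have h2 := Submodule.smul_mem _ ((a ⬝ᵥ x : ℤ) : ℝ)⁻¹ h1
  rwa [smul_smul, inv_mul_cancel₀ (by exact_mod_cast hax), one_smul] at h2

lemma realSpan_slice_le (H : Submodule ℤ (ι → ℤ)) (a : ι → ℤ) :
    realSpan (slice H a) ≤ realSpan H :=
  Submodule.span_mono (Set.image_mono inf_le_left)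

lemma finrank_slice {H : Submodule ℤ (ι → ℤ)} {a x : ι → ℤ} (hx : x ∈ H) (hax : a ⬝ᵥ x ≠ 0) :
    Module.finrank ℤ (slice H a) + 1 = Module.finrank ℤ H := by
  set f : H →ₗ[ℤ] ℤ := (dotProductBilin ℤ ℤ a).comp H.subtype with hf
  have h1 := Submodule.finrank_quotient_add_finrank (LinearMap.ker f)
  rw [f.quotKerEquivRange.finrank_eq] at h1
  have h2 : Module.finrank ℤ (LinearMap.range f) = 1 := by
    apply le_antisymm
    · simpa using Submodule.finrank_le (LinearMap.range f)
    · rw [Nat.one_le_iff_ne_zero, Ne, Submodule.finrank_eq_zero]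
      intro h
      apply hax
      have : f ⟨x, hx⟩ ∈ LinearMap.range f := ⟨_, rfl⟩
      rw [h] at this
      exact this
  have h3 : (LinearMap.ker f).map H.subtype = slice H a := by
    ext z
    simp [slice, hf, and_comm]
  have h4 := LinearEquiv.finrank_eq
    (Submodule.equivMapOfInjective H.subtype H.injective_subtype (LinearMap.ker f))
  rw [h3] at h4
  omega

/-- The point `v` is generic relative to `H`: an integral functional takes an integral value at `v`
only if it vanishes on `H`. -/
def IsGeneric (H : Submodule ℤ (ι → ℤ)) (v : ι → ℝ) : Prop :=
  ∀ (a : ι → ℤ) (n : ℤ), pairing a v = n → ∀ h ∈ H, a ⬝ᵥ h = 0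

lemma IsGeneric.slice {H : Submodule ℤ (ι → ℤ)} {v : ι → ℝ} (hv : IsGeneric H v)
    {a x : ι → ℤ} (hax : a ⬝ᵥ x ≠ 0) {s : ℝ} {n : ℤ}
    (hn : pairing a (v + s • toReal x) = n) : IsGeneric (slice H a) (v + s • toReal x) := by
  intro b m hm h hh
  have h1 := pairing_sub_smul b a (a ⬝ᵥ x) (b ⬝ᵥ x) (v + s • toReal x)
  have h0 : ((a ⬝ᵥ x) • b - (b ⬝ᵥ x) • a) ⬝ᵥ x = 0 := by
    rw [sub_dotProduct, smul_dotProduct, smul_dotProduct, smul_eq_mul, smul_eq_mul]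
    ring
  rw [hn, hm, map_add, map_smul, pairing_toReal, h0, Int.cast_zero, smul_zero, add_zero] at h1
  have h2 := hv _ ((a ⬝ᵥ x) * m - (b ⬝ᵥ x) * n) (by push_cast; exact h1) h hh.1
  rw [sub_dotProduct, smul_dotProduct, smul_dotProduct, (mem_slice.1 hh).2, smul_zero, sub_zero,
    smul_eq_mul] at h2
  exact (mul_eq_zero.1 h2).resolve_left hax

/-- The lattice points of `v + realSpan H` that satisfy the inequalities `c j ≥ c j v`. -/
def cell {J : Type*} (c : J → ι → ℤ) (H : Submodule ℤ (ι → ℤ)) (v : ι → ℝ) : Set (ι → ℤ) :=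
  {z | toReal z - v ∈ realSpan H ∧ ∀ j, pairing (c j) v ≤ (c j ⬝ᵥ z : ℤ)}

/-- If a generic cell of `H` is nonempty and every element of `H` in the cone lies on all walls of
it, then `H` itself lies on all walls. For a lattice point `z` of the cell, `z - v` is positive for
every functional that does not vanish on `H`, and a nearby rational direction has a multiple in `H`
with the same property. -/
lemma dotProduct_eq_zero_of_cell_nonempty {J : Type*} [Finite J] {c : J → ι → ℤ}
    {H : Submodule ℤ (ι → ℤ)} {v : ι → ℝ} (hv : IsGeneric H v) (hne : (cell c H v).Nonempty)
    (hH : ∀ x ∈ H, (∀ j, 0 ≤ c j ⬝ᵥ x) → ∀ j, c j ⬝ᵥ x = 0) :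
    ∀ h ∈ H, ∀ j, c j ⬝ᵥ h = 0 := by
  obtain ⟨z, hz, hzj⟩ := hne
  obtain ⟨h, hh, hpos⟩ := exists_mem_forall_pos c hz
  have key : ∀ j, 0 < c j ⬝ᵥ h ∨ ∀ h ∈ H, c j ⬝ᵥ h = 0 := by
    intro j
    have h1 : pairing (c j) (toReal z - v) = (c j ⬝ᵥ z : ℤ) - pairing (c j) v := by
      rw [map_sub, pairing_toReal]
    rcases (hzj j).lt_or_eq with h2 | h2
    · exact Or.inl (hpos j (by rw [h1]; linarith))
    · exact Or.inr (hv _ _ h2)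
  have h3 := hH h hh fun j => (key j).elim le_of_lt fun h0 => (h0 h hh).ge
  intro x hx j
  exact ((key j).resolve_left (h3 j).not_gt) x hx

end Geometry

/-! ### Sweeping a cell across hyperplanes -/

section Sweep

variable {ι : Type v} [Fintype ι]

/-- A subgroup of rank `n` contains `n` elements in triangular position with respect to suitable
integral functionals. -/
lemma exists_triangular (n : ℕ) (H : Submodule ℤ (ι → ℤ)) (hn : Module.finrank ℤ H = n) :
    ∃ y : Fin n → ι → ℤ, (∀ i, y i ∈ H) ∧
      ∀ i, ∃ l : (ι → ℤ) →+ ℤ, (∀ j < i, l (y j) = 0) ∧ 0 < l (y i) := by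
  classical
  induction n generalizing H with
  | zero => exact ⟨fun i => i.elim0, fun i => i.elim0, fun i => i.elim0⟩
  | succ n ih =>
    have hne : H ≠ ⊥ := by
      rintro rfl
      simp at hn
    obtain ⟨h, hh, h0⟩ := (Submodule.ne_bot_iff H).1 hne
    obtain ⟨i₀, hi₀⟩ := Function.ne_iff.1 h0
    have hdot : ∀ z : ι → ℤ, Pi.single i₀ 1 ⬝ᵥ z = z i₀ := fun z => by simp
    have h1 := finrank_slice (a := Pi.single i₀ 1) hh (by rwa [hdot])
    obtain ⟨y, hy, hl⟩ := ih (slice H (Pi.single i₀ 1)) (by omega)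
    refine ⟨Fin.snoc y h, ?_, ?_⟩
    · intro i
      refine Fin.lastCases ?_ (fun i => ?_) i
      · simpa using hh
      · simpa using (hy i).1
    · intro i
      refine Fin.lastCases ?_ (fun i => ?_) i
      · refine ⟨(SignType.sign (h i₀) : ℤ) • Pi.evalAddMonoidHom (fun _ => ℤ) i₀, ?_, ?_⟩
        · intro j hj
          obtain ⟨j, rfl⟩ := Fin.exists_castSucc_eq.2 hj.ne
          have := (mem_slice.1 (hy j)).2
          rw [hdot] at this
          simp [this]
        · simpa [sign_mul_self] using hi₀
      · obtain ⟨l, h2, h3⟩ := hl i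
        refine ⟨l, fun j hj => ?_, by simpa using h3⟩
        obtain ⟨j, rfl⟩ := Fin.exists_castSucc_eq.2 (hj.trans_le (Fin.le_last _)).ne
        simpa using h2 j (Fin.castSucc_lt_castSucc_iff.1 hj)

variable {J : Type*}

/-- The lattice points of the cone defined by the inequalities `c j ≥ 0`. -/
def coneSemigroup (c : J → ι → ℤ) : AddSubmonoid (ι → ℤ) where
  carrier := {z | ∀ j, 0 ≤ c j ⬝ᵥ z}
  zero_mem' j := by simp
  add_mem' hx hy j := by
    rw [dotProduct_add]
    exact add_nonneg (hx j) (hy j)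

lemma pairing_add_smul (a x : ι → ℤ) (v : ι → ℝ) (s : ℝ) :
    pairing a (v + s • toReal x) = pairing a v + s * (a ⬝ᵥ x : ℤ) := by
  rw [map_add, map_smul, pairing_toReal, smul_eq_mul]

variable {c : J → ι → ℤ} {H : Submodule ℤ (ι → ℤ)} {v : ι → ℝ} {x : ι → ℤ}

lemma cell_anti (hx : x ∈ H) (hxc : ∀ j, 0 ≤ c j ⬝ᵥ x) {s t : ℝ} (hst : s ≤ t) :
    cell c H (v + t • toReal x) ⊆ cell c H (v + s • toReal x) := by
  rintro z ⟨h1, h2⟩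
  refine ⟨?_, fun j => le_trans ?_ (h2 j)⟩
  · have := Submodule.add_mem _ h1 (Submodule.smul_mem _ (t - s) (toReal_mem_realSpan hx))
    convert this using 1
    module
  · rw [pairing_add_smul, pairing_add_smul]
    have : (0 : ℝ) ≤ (c j ⬝ᵥ x : ℤ) := by exact_mod_cast hxc j
    nlinarith

/-- The last moment before `s` at which the point moving from `v` in direction `x` meets a
hyperplane `c j = t` with `t` integral. -/
lemma exists_last_event [Finite J] (hxc : ∀ j, 0 ≤ c j ⬝ᵥ x) {s : ℝ}
    (hex : ∃ j, ⌈pairing (c j) v⌉ < ⌈pairing (c j) (v + s • toReal x)⌉) :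
    ∃ s₀ : ℝ, 0 ≤ s₀ ∧ s₀ < s ∧ ∃ j, 0 < c j ⬝ᵥ x ∧
      (∃ n : ℤ, pairing (c j) (v + s₀ • toReal x) = n) ∧
      ⌈pairing (c j) (v + s₀ • toReal x)⌉ < ⌈pairing (c j) (v + s • toReal x)⌉ ∧
      ∀ j', ∀ t : ℤ, pairing (c j') (v + s₀ • toReal x) ≤ t →
        t < pairing (c j') (v + s • toReal x) → pairing (c j') (v + s₀ • toReal x) = t := by
  classical
  have := Fintype.ofFinite J
  set F : Finset J := {j | ⌈pairing (c j) v⌉ < ⌈pairing (c j) (v + s • toReal x)⌉} with hF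
  let τ : J → ℝ := fun j =>
    ((⌈pairing (c j) (v + s • toReal x)⌉ : ℝ) - 1 - pairing (c j) v) / (c j ⬝ᵥ x : ℤ)
  obtain ⟨j₁, hj₁⟩ := hex
  obtain ⟨j, hj, hmax⟩ := F.exists_max_image τ ⟨j₁, by simpa [hF] using hj₁⟩
  have hpos : ∀ j ∈ F, 0 < c j ⬝ᵥ x := by
    intro j hj
    refine lt_of_le_of_ne (hxc j) fun h => ?_
    simp [hF, pairing_add_smul, ← h] at hj
  have hτ : ∀ j ∈ F, pairing (c j) (v + τ j • toReal x) =
      (⌈pairing (c j) (v + s • toReal x)⌉ : ℝ) - 1 := by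
    intro j hj
    have : (0 : ℝ) < (c j ⬝ᵥ x : ℤ) := by exact_mod_cast hpos j hj
    rw [pairing_add_smul, div_mul_cancel₀ _ this.ne']
    ring
  have hcj : (0 : ℝ) < (c j ⬝ᵥ x : ℤ) := by exact_mod_cast hpos j hj
  have hjF : ⌈pairing (c j) v⌉ < ⌈pairing (c j) (v + s • toReal x)⌉ := by simpa [hF] using hj
  have hτ0 : 0 ≤ τ j := by
    apply div_nonneg _ hcj.le
    have h1 : (⌈pairing (c j) v⌉ : ℝ) + 1 ≤ ⌈pairing (c j) (v + s • toReal x)⌉ := by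
      exact_mod_cast hjF
    have h2 := Int.le_ceil (pairing (c j) v)
    linarith
  refine ⟨τ j, hτ0, ?_, j, hpos j hj, ?_, ?_, ?_⟩
  · rw [div_lt_iff₀ hcj]
    have := Int.ceil_lt_add_one (pairing (c j) (v + s • toReal x))
    rw [pairing_add_smul] at this ⊢
    linarith
  · exact ⟨⌈pairing (c j) (v + s • toReal x)⌉ - 1, by rw [hτ j hj]; push_cast; rfl⟩
  · rw [hτ j hj]
    have : ((⌈pairing (c j) (v + s • toReal x)⌉ : ℝ) - 1) =
      ((⌈pairing (c j) (v + s • toReal x)⌉ - 1 : ℤ) : ℝ) := by push_cast; rfl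
    rw [this, Int.ceil_intCast]
    omega
  · intro j' t h1 h2
    have h3 : t < ⌈pairing (c j') (v + s • toReal x)⌉ := Int.lt_ceil.2 h2
    have h4 : pairing (c j') v ≤ t := by
      refine le_trans ?_ h1
      rw [pairing_add_smul]
      have : (0 : ℝ) ≤ (c j' ⬝ᵥ x : ℤ) := by exact_mod_cast hxc j'
      have := mul_nonneg hτ0 this
      linarith
    have h5 : j' ∈ F := by
      simp only [hF, Finset.mem_filter, Finset.mem_univ, true_and]
      exact (Int.ceil_le.2 h4).trans_lt h3
    have h6 := hmax j' h5
    have h7 : pairing (c j') (v + τ j' • toReal x) ≤ pairing (c j') (v + τ j • toReal x) := by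
      rw [pairing_add_smul, pairing_add_smul]
      have : (0 : ℝ) ≤ (c j' ⬝ᵥ x : ℤ) := by exact_mod_cast hxc j'
      nlinarith
    rw [hτ j' h5] at h7
    have h8 : (t : ℝ) + 1 ≤ ⌈pairing (c j') (v + s • toReal x)⌉ := by exact_mod_cast h3
    exact le_antisymm h1 (by linarith)

/-- Between the last event `s₀` and `s` the cell loses exactly the points of one wall, which form
a cell of the slice of `H`; by genericity all walls met at `s₀` are the same. -/
lemma cell_sdiff_cell (hv : IsGeneric H v) (hx : x ∈ H) {s s₀ : ℝ}
    (hs : s₀ < s) {j : J} (hj : 0 < c j ⬝ᵥ x) {n : ℤ}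
    (hn : pairing (c j) (v + s₀ • toReal x) = n)
    (hlast : ∀ j', ∀ t : ℤ, pairing (c j') (v + s₀ • toReal x) ≤ t →
        t < pairing (c j') (v + s • toReal x) → pairing (c j') (v + s₀ • toReal x) = t) :
    cell c H (v + s₀ • toReal x) \ cell c H (v + s • toReal x) =
      cell c (slice H (c j)) (v + s₀ • toReal x) := by
  ext z
  constructor
  · rintro ⟨⟨h1, h2⟩, h3⟩
    refine ⟨?_, h2⟩
    have h4 : toReal z - (v + s • toReal x) ∈ realSpan H := by
      have := Submodule.sub_mem _ h1 (Submodule.smul_mem _ (s - s₀) (toReal_mem_realSpan hx))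
      convert this using 1
      module
    obtain ⟨j', hj'⟩ : ∃ j', ((c j' ⬝ᵥ z : ℤ) : ℝ) < pairing (c j') (v + s • toReal x) := by
      by_contra! h
      exact h3 ⟨h4, h⟩
    have h5 := hlast j' _ (h2 j') hj'
    have hj'x : c j' ⬝ᵥ x ≠ 0 := by
      intro h0
      rw [pairing_add_smul, h0] at h5 hj'
      simp at h5 hj'
      linarith
    have h6 : toReal z - (v + s₀ • toReal x) ∈ realSpan (slice H (c j')) := by
      refine mem_realSpan_slice hx hj'x h1 ?_
      rw [map_sub, pairing_toReal, h5, sub_self]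
    have h7 : slice H (c j') ≤ slice H (c j) := fun h hh =>
      mem_slice.2 ⟨(mem_slice.1 hh).1, hv.slice hj'x h5 (c j) n hn h hh⟩
    exact Submodule.span_mono (Set.image_mono h7) h6
  · rintro ⟨h1, h2⟩
    refine ⟨⟨realSpan_slice_le _ _ h1, h2⟩, fun h3 => ?_⟩
    have h4 := pairing_eq_zero_of_mem_realSpan (a := c j) (fun h hh => (mem_slice.1 hh).2) h1
    rw [map_sub, pairing_toReal, sub_eq_zero, pairing_add_smul] at h4
    have h5 := h3.2 j
    rw [h4, pairing_add_smul] at h5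
    have : (0 : ℝ) < (c j ⬝ᵥ x : ℤ) := by exact_mod_cast hj
    nlinarith

lemma sub_mem_cell {z : ι → ℤ} (hz : z ∈ cell c H (v + (1 : ℝ) • toReal x)) :
    z - x ∈ cell c H v := by
  obtain ⟨h1, h2⟩ := hz
  refine ⟨?_, fun j => ?_⟩
  · convert h1 using 1
    rw [map_sub]
    module
  · have := h2 j
    rw [pairing_add_smul] at this
    rw [dotProduct_sub]
    push_cast
    linarith

lemma add_mem_cell {z : ι → ℤ} (hz : z ∈ cell c H v) :
    z + x ∈ cell c H (v + (1 : ℝ) • toReal x) := by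
  obtain ⟨h1, h2⟩ := hz
  refine ⟨?_, fun j => ?_⟩
  · convert h1 using 1
    rw [map_add]
    module
  · have := h2 j
    rw [pairing_add_smul, dotProduct_add]
    push_cast
    linarith

/-- A stable set that is enlarged by the part `cell c H w` of the cell `U \ U'` remains stable. -/
lemma isStable_union_cell {U U' : Set (ι → ℤ)} (hU : IsStable (coneSemigroup c) U)
    (hU' : IsStable (coneSemigroup c) U') (hcell : U \ U' = cell c H v)
    {w : ι → ℝ} (hw : w - v ∈ realSpan H) (hwv : cell c H w ⊆ cell c H v) :
    IsStable (coneSemigroup c) (U' ∪ cell c H w) := by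
  rintro a ha z (hz | hz)
  · exact Or.inl (hU' a ha z hz)
  · by_cases h : a + z ∈ U'
    · exact Or.inl h
    · right
      have h1 : z ∈ U \ U' := hcell ▸ hwv hz
      have h2 : a + z ∈ cell c H v := hcell ▸ ⟨hU a ha z h1.1, h⟩
      refine ⟨?_, fun j => (hz.2 j).trans ?_⟩
      · have := Submodule.sub_mem _ h2.1 hw
        convert this using 1
        abel
      · rw [dotProduct_add]
        exact_mod_cast le_add_of_nonneg_left (ha j)

end Sweep

/-! ### Depth of the modules spanned by cells -/

section Depth

variable {k : Type u} [Field k] {ι : Type v}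

/-- The subquotient spanned by the monomials with exponents in `U \ V`, for stable sets `V ⊆ U`,
has depth at least `n` with respect to `N`. -/
def DepthOn {M : AddSubmonoid (ι → ℤ)} (N : ModuleCat.{max u v} (monoidSubalgebra k M))
    (U V : Set (ι → ℤ)) (n : ℕ) : Prop :=
  ∀ (hU : IsStable M U) (hV : IsStable M V),
    DepthGE N (.of _ (Subquotient (supportedIn k U hU) (supportedIn k V hV))) n

/-- Depth along a filtration `W ⊆ V ⊆ U` of stable sets. -/
lemma DepthOn.trans {M : AddSubmonoid (ι → ℤ)}
    {N : ModuleCat.{max u v} (monoidSubalgebra k M)} {U V W : Set (ι → ℤ)} {n : ℕ}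
    (hV : IsStable M V) (hVU : V ⊆ U) (hWV : W ⊆ V) (h1 : DepthOn N V W n)
    (h2 : DepthOn N U V n) : DepthOn N U W n := fun hU hW =>
  DepthGE.subquotient_trans (A := supportedIn k W hW) (B := supportedIn k V hV)
    (C := supportedIn k U hU) (supportedIn_mono hWV) (supportedIn_mono hVU) (h1 hV hW) (h2 hU hV)

lemma DepthOn.of_subset {M : AddSubmonoid (ι → ℤ)}
    {N : ModuleCat.{max u v} (monoidSubalgebra k M)} {U V : Set (ι → ℤ)} {n : ℕ}
    (hUV : U ⊆ V) : DepthOn N U V n := fun hU hV => by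
  have := subquotient_subsingleton (supportedIn_mono (k := k) (hU := hU) (hV := hV) hUV)
  exact DepthGE.of_subsingleton _ _

/-- Multiplication by the monomial `t^x` maps the subquotient of `U \ W` injectively to itself,
with cokernel the subquotient of `U \ V`. -/
lemma DepthOn.succ {M : AddSubmonoid (ι → ℤ)}
    {N : ModuleCat.{max u v} (monoidSubalgebra k M)} {U V W : Set (ι → ℤ)} {n : ℕ}
    (hV : IsStable M V) (hWV : W ⊆ V) {x : ι → ℤ} (hx : x ∈ M)
    (hxN : monomialOf k ⟨x, hx⟩ ∈ Module.annihilator _ N)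
    (h1 : ∀ z ∈ U, z + x ∈ W → z ∈ W) (h2 : ∀ z ∈ U, z + x ∈ V)
    (h3 : ∀ z ∈ V, z ∉ W → z - x ∈ U) (h : DepthOn N U V n) : DepthOn N U W (n + 1) := by
  classical
  intro hU hW
  refine DepthGE.subquotient_succ (B := supportedIn k V hV) (supportedIn_mono hWV)
    (r := monomialOf k ⟨x, hx⟩) ?_ ?_ ?_ hxN (h hU hV)
  · intro f hf hfx z hz
    refine h1 z (hf z hz) (hfx _ ?_)
    rw [monomialOf_smul_coeff]
    simpa using hz
  · intro f hf z hz
    rw [monomialOf_smul_coeff] at hz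
    simpa using h2 _ (hf _ hz)
  · intro b hb
    set a : k[ι → ℤ] := .ofCoeff (b.coeff.filter (· ∈ W)) with ha
    have hacoeff : ∀ z, a.coeff z = if z ∈ W then b.coeff z else 0 := fun z => by
      rw [ha]
      exact Finsupp.filter_apply _ _ _
    refine ⟨a, ?_, single (-x) 1 * (b - a), ?_, ?_⟩
    · intro z hz
      rw [hacoeff] at hz
      by_contra h
      exact hz (if_neg h)
    · intro z hz
      rw [coeff_single_mul_apply, one_mul, neg_neg, coeff_sub, Finsupp.sub_apply,
        hacoeff] at hz
      have h4 : x + z ∉ W := fun h => hz (by rw [if_pos h, sub_self])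
      rw [if_neg h4, sub_zero] at hz
      simpa using h3 _ (hb _ hz) h4
    · change b = a + single x 1 * (single (-x) 1 * (b - a))
      rw [← mul_assoc, single_mul_single, add_neg_cancel, one_mul, ← one_def, one_mul,
        add_sub_cancel]

variable [Fintype ι] {J : Type*} [Finite J] {c : J → ι → ℤ}

/-- Sweeping a cell of `H` from `v` to `v + s x` removes walls one at a time; each of them is a
cell of a slice of `H`. -/
lemma depthOn_sweep {N : ModuleCat.{max u v} (monoidSubalgebra k (coneSemigroup c))} {n : ℕ}
    {H : Submodule ℤ (ι → ℤ)} (hn : Module.finrank ℤ H = n + 1) {v : ι → ℝ}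
    (hv : IsGeneric H v) {U U' : Set (ι → ℤ)} (hU : IsStable (coneSemigroup c) U)
    (hU' : IsStable (coneSemigroup c) U') (hUU' : U' ⊆ U) (hcell : U \ U' = cell c H v)
    (ih : ∀ (H : Submodule ℤ (ι → ℤ)), Module.finrank ℤ H = n → ∀ (v : ι → ℝ), IsGeneric H v →
      ∀ V V' : Set (ι → ℤ), V' ⊆ V → V \ V' = cell c H v → DepthOn N V V' n)
    {x : ι → ℤ} (hx : x ∈ H) (hxc : ∀ j, 0 ≤ c j ⬝ᵥ x) {s : ℝ} (hs : 0 ≤ s) :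
    DepthOn N U (U' ∪ cell c H (v + s • toReal x)) n := by
  have := Fintype.ofFinite J
  have hmem : ∀ s : ℝ, v + s • toReal x - v ∈ realSpan H := fun s => by
    rw [add_sub_cancel_left]
    exact Submodule.smul_mem _ s (toReal_mem_realSpan hx)
  have hsub : ∀ s : ℝ, 0 ≤ s → cell c H (v + s • toReal x) ⊆ cell c H v := fun s hs => by
    simpa using cell_anti (v := v) hx hxc hs
  have hceil : ∀ r t : ℝ, r ≤ t → ∀ j, ⌈pairing (c j) (v + r • toReal x)⌉ ≤
      ⌈pairing (c j) (v + t • toReal x)⌉ := by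
    intro r t hrt j
    apply Int.ceil_le_ceil
    rw [pairing_add_smul, pairing_add_smul]
    have : (0 : ℝ) ≤ (c j ⬝ᵥ x : ℤ) := by exact_mod_cast hxc j
    nlinarith
  -- The number of wall crossings between `v` and `v + s x`.
  obtain ⟨m, hm⟩ : ∃ m : ℕ,
      ∑ j, (⌈pairing (c j) (v + s • toReal x)⌉ - ⌈pairing (c j) v⌉) = m := by
    refine Int.eq_ofNat_of_zero_le (Finset.sum_nonneg fun j _ => sub_nonneg.2 ?_)
    simpa using hceil 0 s hs j
  induction m using Nat.strong_induction_on generalizing s with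
  | _ m ihm =>
  by_cases hex : ∃ j, ⌈pairing (c j) v⌉ < ⌈pairing (c j) (v + s • toReal x)⌉
  · obtain ⟨s₀, hs₀, hss, j, hj, ⟨t, ht⟩, hlt, hlast⟩ := exists_last_event hxc hex
    have hdiff := cell_sdiff_cell hv hx hss hj ht hlast
    have hanti := cell_anti (c := c) (v := v) hx hxc hss.le
    obtain ⟨m₀, hm₀⟩ : ∃ m : ℕ,
        ∑ j, (⌈pairing (c j) (v + s₀ • toReal x)⌉ - ⌈pairing (c j) v⌉) = m := by
      refine Int.eq_ofNat_of_zero_le (Finset.sum_nonneg fun j _ => sub_nonneg.2 ?_)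
      simpa using hceil 0 s₀ hs₀ j
    have hsum : ∑ j, (⌈pairing (c j) (v + s₀ • toReal x)⌉ - ⌈pairing (c j) v⌉) <
        ∑ j, (⌈pairing (c j) (v + s • toReal x)⌉ - ⌈pairing (c j) v⌉) := by
      refine Finset.sum_lt_sum (fun j _ => ?_) ⟨j, Finset.mem_univ _, by omega⟩
      have := hceil s₀ s hss.le j
      omega
    refine DepthOn.trans (isStable_union_cell hU hU' hcell (hmem s₀) (hsub s₀ hs₀))
      (Set.union_subset hUU' ((hsub s₀ hs₀).trans (hcell ▸ Set.sdiff_subset)))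
      (Set.union_subset_union_right _ hanti) ?_ (ihm m₀ (by omega) hs₀ hm₀)
    refine ih (slice H (c j)) ?_ _ (hv.slice hj.ne' ht) _ _
      (Set.union_subset_union_right _ hanti) ?_
    · have := finrank_slice hx hj.ne'
      omega
    · rw [← hdiff]
      ext z
      have : z ∈ cell c H (v + s₀ • toReal x) → z ∉ U' := fun h h' => by
        have h3 : z ∈ U \ U' := hcell ▸ hsub s₀ hs₀ h
        exact h3.2 h'
      simp only [Set.mem_sdiff, Set.mem_union]
      tauto
  · push Not at hex
    apply DepthOn.of_subset
    intro z hz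
    by_cases hz' : z ∈ U'
    · exact Or.inl hz'
    · right
      have h1 : z ∈ cell c H v := hcell ▸ ⟨hz, hz'⟩
      refine ⟨?_, fun j => ?_⟩
      · have := Submodule.sub_mem _ h1.1 (hmem s)
        convert this using 1
        abel
      · have h2 := Int.ceil_le.2 (h1.2 j)
        exact (Int.le_ceil _).trans (by exact_mod_cast (hex j).trans h2)

/-- The subquotient spanned by the monomials of a cell of `H` has depth at least the rank of `H`
with respect to `N`, provided that `N` is killed by the noninvertible monomials and that every
monomial acts algebraically on it. The proof is by induction on the rank of `H`. If `H` contains a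
noninvertible monomial `t^x`, it acts injectively, and the cokernel is filtered by cells of slices
of `H`, since moving the cell by `x` removes its walls one at a time. Otherwise a nonempty cell
consists of invertible monomials, up to translation. -/
theorem depthOn_of_cell
    (N : ModuleCat.{max u v} (monoidSubalgebra k (coneSemigroup c)))
    (hmono : ∀ x : coneSemigroup c, (∃ j, 0 < c j ⬝ᵥ (x : ι → ℤ)) →
      monomialOf k x ∈ Module.annihilator _ N)
    (halg : ∀ x : coneSemigroup c, ∃ p : Polynomial k, p ≠ 0 ∧
      Polynomial.aeval (monomialOf k x) p ∈ Module.annihilator _ N)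
    (n : ℕ) (H : Submodule ℤ (ι → ℤ)) (hn : Module.finrank ℤ H = n) (v : ι → ℝ)
    (hv : IsGeneric H v) (U U' : Set (ι → ℤ)) (hUU' : U' ⊆ U) (hcell : U \ U' = cell c H v) :
    DepthOn N U U' n := by
  induction n generalizing H v U U' with
  | zero => intro _ _ i hi; omega
  | succ n ih =>
    intro hU hU'
    by_cases hcase : ∃ x ∈ H, (∀ j, 0 ≤ c j ⬝ᵥ x) ∧ ∃ j, c j ⬝ᵥ x ≠ 0
    · obtain ⟨x, hx, hxc, j₀, hj₀⟩ := hcase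
      have hmem : v + (1 : ℝ) • toReal x - v ∈ realSpan H := by
        rw [add_sub_cancel_left]
        exact Submodule.smul_mem _ _ (toReal_mem_realSpan hx)
      have hsub : cell c H (v + (1 : ℝ) • toReal x) ⊆ cell c H v := by
        simpa using cell_anti (v := v) hx hxc (zero_le_one' ℝ)
      -- The cell at `v + x` is the translate of the cell at `v` by `x`.
      refine DepthOn.succ (isStable_union_cell hU hU' hcell hmem hsub) Set.subset_union_left hxc
        (hmono ⟨x, hxc⟩ ⟨j₀, lt_of_le_of_ne (hxc j₀) hj₀.symm⟩) ?_ ?_ ?_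
        (depthOn_sweep hn hv hU hU' hUU' hcell ih hx hxc zero_le_one) hU hU'
      · intro z hz hzx
        by_contra hz'
        have h1 : z ∈ cell c H v := hcell ▸ ⟨hz, hz'⟩
        have h4 : z + x ∈ U \ U' := hcell ▸ hsub (add_mem_cell (x := x) h1)
        exact h4.2 hzx
      · intro z hz
        by_cases hz' : z ∈ U'
        · left
          rw [add_comm]
          exact hU' x hxc _ hz'
        · right
          have h1 : z ∈ cell c H v := hcell ▸ ⟨hz, hz'⟩
          exact add_mem_cell (x := x) h1
      · intro z hz hz'
        have h3 : z - x ∈ U \ U' := by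
          rw [hcell]
          exact sub_mem_cell (hz.resolve_left hz')
        exact h3.1
    · push Not at hcase
      rcases (cell c H v).eq_empty_or_nonempty with he | hne
      · exact DepthOn.of_subset (by rwa [he, Set.sdiff_eq_empty] at hcell) hU hU'
      · have hunit := dotProduct_eq_zero_of_cell_nonempty hv hne hcase
        obtain ⟨y, hy, hl⟩ := exists_triangular (n + 1) H hn
        have hyM : ∀ i, y i ∈ coneSemigroup c := fun i j => (hunit _ (hy i) j).ge
        choose p hp0 hp using fun i => halg ⟨y i, hyM i⟩
        refine depthGE_of_units N (S := ∅) (supportedIn_mono hUU')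
          (isHomogeneousOff_supportedIn _ _) (isHomogeneousOff_supportedIn _ _)
          (fun i => ⟨y i, hyM i⟩) (fun i j => ?_) p hp0 hp ?_
        · rw [dotProduct_neg, hunit _ (hy i) j, neg_zero]
        · intro i
          obtain ⟨l, h1, h2⟩ := hl i
          exact ⟨l, fun _ h => absurd h (Set.notMem_empty _), h1, h2⟩

end Depth

/-! ### Existence of generic points -/

section GenericPoint

variable {ι : Type v} [Fintype ι] {J : Type*} [Finite J]

lemma volume_pairing_eq (a : ι → ℤ) (ha : a ≠ 0) (t : ℝ) :
    MeasureTheory.volume {v : ι → ℝ | pairing a v = t} = 0 := by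
  classical
  let s : AffineSubspace ℝ (ι → ℝ) :=
    (AffineSubspace.mk' t ⊥).comap (pairing a).toAffineMap
  have hs : (s : Set (ι → ℝ)) = {v : ι → ℝ | pairing a v = t} := by
    ext v
    simp [s, sub_eq_zero]
  rw [← hs]
  apply MeasureTheory.Measure.addHaar_affineSubspace
  intro htop
  obtain ⟨i, hi⟩ := Function.ne_iff.1 ha
  have h1 : ∀ v : ι → ℝ, pairing a v = t := fun v => by
    have : v ∈ (s : Set (ι → ℝ)) := by rw [htop]; trivial
    rwa [hs] at this
  have h2 := h1 0
  have h3 := h1 (toReal (Pi.single i 1))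
  rw [map_zero] at h2
  rw [← h2, pairing_toReal] at h3
  simp at h3
  exact hi h3

/-- Arbitrarily close to the origin there are generic points at which the functionals `c j` are
negative. -/
lemma exists_generic (c : J → ι → ℤ) (x₀ : ι → ℤ) (hx₀ : ∀ j, 0 < c j ⬝ᵥ x₀) :
    ∃ v : ι → ℝ, IsGeneric ⊤ v ∧ ∀ j, -1 < pairing (c j) v ∧ pairing (c j) v < 0 := by
  have := Fintype.ofFinite J
  -- The points to be avoided lie on countably many hyperplanes.
  have hae : ∀ᵐ v : ι → ℝ, ∀ a : ι → ℤ, ∀ n : ℤ, a ≠ 0 → pairing a v ≠ n := by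
    rw [MeasureTheory.ae_all_iff]
    intro a
    rw [MeasureTheory.ae_all_iff]
    intro n
    by_cases ha : a = 0
    · simp [ha]
    · have := volume_pairing_eq a ha n
      filter_upwards [MeasureTheory.measure_eq_zero_iff_ae_notMem.1 this] with v hv _
      exact hv
  have hopen : IsOpen {v : ι → ℝ | ∀ j, -1 < pairing (c j) v ∧ pairing (c j) v < 0} := by
    simp only [Set.ofPred_forall]
    refine isOpen_iInter_of_finite fun j => ?_
    have hcont := LinearMap.continuous_of_finiteDimensional (pairing (c j))
    exact (isOpen_lt (α := ℝ) continuous_const hcont).inter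
      (isOpen_lt (α := ℝ) hcont continuous_const)
  have hne : {v : ι → ℝ | ∀ j, -1 < pairing (c j) v ∧ pairing (c j) v < 0}.Nonempty := by
    set K : ℤ := 1 + ∑ j, c j ⬝ᵥ x₀ with hK
    have hK1 : ∀ j, c j ⬝ᵥ x₀ < K := fun j => by
      have := Finset.single_le_sum (f := fun j => c j ⬝ᵥ x₀) (fun j _ => (hx₀ j).le)
        (Finset.mem_univ j)
      omega
    have hK0 : 0 < K := by
      have := Finset.sum_nonneg (f := fun j => c j ⬝ᵥ x₀) (s := Finset.univ)
        fun j _ => (hx₀ j).le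
      omega
    -- `K` exceeds all `c j x₀`, so that `-x₀ / K` satisfies both inequalities.
    refine ⟨-((K : ℝ)⁻¹ • toReal x₀), fun j => ?_⟩
    rw [map_neg, map_smul, pairing_toReal, smul_eq_mul]
    have h0 : (0 : ℝ) < K := by exact_mod_cast hK0
    have h1 : (0 : ℝ) < (c j ⬝ᵥ x₀ : ℤ) := by exact_mod_cast hx₀ j
    have h2 : ((c j ⬝ᵥ x₀ : ℤ) : ℝ) < K := by exact_mod_cast hK1 j
    constructor
    · rw [neg_lt_neg_iff, inv_mul_lt_one₀ h0]
      exact h2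
    · rw [neg_lt_zero]
      positivity
  have hpos := hopen.measure_pos MeasureTheory.volume hne
  obtain ⟨v, hv1, hv2⟩ : ∃ v, (∀ a : ι → ℤ, ∀ n : ℤ, a ≠ 0 → pairing a v ≠ n) ∧
      v ∈ {v : ι → ℝ | ∀ j, -1 < pairing (c j) v ∧ pairing (c j) v < 0} := by
    by_contra! h
    refine hpos.ne' (MeasureTheory.measure_mono_null ?_ hae)
    intro v hv hv'
    exact h v hv' hv
  refine ⟨v, fun a n han h _ => ?_, hv2⟩
  by_contra h0
  refine hv1 a n (fun ha => h0 ?_) han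
  simp [ha]

end GenericPoint

/-! ### Regular sequences in algebras of cones -/

section RegularSequence

lemma DepthGE.congr {R : Type u} [CommRing R] {A B : Type u} [AddCommGroup A] [Module R A]
    [AddCommGroup B] [Module R B] (e : A ≃ₗ[R] B) {N : ModuleCat.{u} R} {n : ℕ}
    (h : DepthGE N (.of R A) n) : DepthGE N (.of R B) n := by
  refine DepthGE.of_exact (f := e.toLinearMap) (g := (0 : B →ₗ[R] PUnit.{u + 1})) e.injective ?_ ?_
    h (DepthGE.of_subsingleton _ _)
  · intro b
    exact ⟨fun _ => e.surjective b, fun _ => rfl⟩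
  · exact fun _ => ⟨0, Subsingleton.elim _ _⟩

/-- The module `R ⧸ m`. -/
abbrev residueModule {R : Type u} [CommRing R] (m : Ideal R) : ModuleCat.{u} R :=
  ModuleCat.of R (R ⧸ m)

lemma mem_annihilator_residueModule {R : Type u} [CommRing R] {m : Ideal R} {r : R}
    (hr : r ∈ m) : r ∈ Module.annihilator R (residueModule m) := by
  change r ∈ Module.annihilator R (R ⧸ m)
  rwa [Ideal.annihilator_quotient]

/-- The Rees theorem: vanishing of `Ext^i(R / m, R)` for `i < n` yields a regular sequence of length
`n` in `m`. -/
lemma DepthGE.exists_isRegular {R : Type u} [CommRing R] [IsNoetherianRing R] {m : Ideal R}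
    [hmax : m.IsMaximal] {n : ℕ} (h : DepthGE (residueModule m) (ModuleCat.of R R) n) :
    ∃ rs : List R, rs.length = n ∧ (∀ r ∈ rs, r ∈ m) ∧
      RingTheory.Sequence.IsRegular R rs := by
  refine ModuleCat.exists_isRegular_of_exists_subsingleton_ext m n
    (ModuleCat.of R R) ?_ (residueModule m) ?_ h
  · change m • (⊤ : Submodule R R) < ⊤
    rw [smul_eq_mul, Ideal.mul_top]
    exact lt_top_iff_ne_top.2 hmax.ne_top
  · change Module.support R (R ⧸ m) = _
    rw [Module.support_eq_zeroLocus, Ideal.annihilator_quotient]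

/-- Every element is algebraic modulo a maximal ideal, by the Nullstellensatz. -/
lemma exists_aeval_mem_of_isMaximal {k : Type*} [Field k] {R : Type*} [CommRing R] [Algebra k R]
    [Algebra.FiniteType k R] (m : Ideal R) [m.IsMaximal] (x : R) :
    ∃ p : Polynomial k, p ≠ 0 ∧ Polynomial.aeval x p ∈ m := by
  let := Ideal.Quotient.field m
  have h1 : Algebra.FiniteType k (R ⧸ m) :=
    Algebra.FiniteType.of_surjective (Ideal.Quotient.mkₐ k m) Ideal.Quotient.mk_surjective
  have h2 : Module.Finite k (R ⧸ m) := finite_of_finite_type_of_isJacobsonRing k (R ⧸ m)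
  obtain ⟨p, hp, hpx⟩ := Algebra.IsIntegral.isIntegral (R := k) (Ideal.Quotient.mk m x)
  refine ⟨p, hp.ne_zero, Ideal.Quotient.eq_zero_iff_mem.1 ?_⟩
  rw [← hpx, ← Polynomial.aeval_def]
  exact (Polynomial.aeval_algHom_apply (Ideal.Quotient.mkₐ k m) x p).symm

lemma realSpan_top {ι : Type*} [Fintype ι] : realSpan (⊤ : Submodule ℤ (ι → ℤ)) = ⊤ := by
  classical
  rw [eq_top_iff]
  intro v _
  have : v = ∑ i, v i • toReal (Pi.single i 1) := by
    ext j
    simp [toReal, Pi.single_apply]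
  rw [this]
  exact Submodule.sum_mem _ fun i _ => Submodule.smul_mem _ _ (toReal_mem_realSpan trivial)

variable {k : Type u} [Field k] {ι : Type v} [Fintype ι] {J : Type*} [Finite J] {c : J → ι → ℤ}

/-- At a generic point close to the origin on which all `c j` are negative, the cell of the full
lattice is the semigroup of the cone itself. -/
lemma depthGE_quotient (x₀ : ι → ℤ) (hx₀ : ∀ j, 0 < c j ⬝ᵥ x₀)
    [Algebra.FiniteType k (monoidSubalgebra k (coneSemigroup c))]
    (m : Ideal (monoidSubalgebra k (coneSemigroup c))) [m.IsMaximal]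
    (hm : ∀ x : coneSemigroup c, (∃ j, 0 < c j ⬝ᵥ (x : ι → ℤ)) → monomialOf k x ∈ m) :
    DepthGE (residueModule m)
      (ModuleCat.of (monoidSubalgebra k (coneSemigroup c))
        (monoidSubalgebra k (coneSemigroup c))) (Fintype.card ι) := by
  obtain ⟨v, hv, hvc⟩ := exists_generic c x₀ hx₀
  have hcell : (coneSemigroup c : Set (ι → ℤ)) \ ∅ = cell c ⊤ v := by
    ext z
    simp only [cell, realSpan_top, Submodule.mem_top, true_and, Set.sdiff_empty]
    refine forall_congr' fun j => ⟨fun h => ?_, fun h => ?_⟩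
    · have : (0 : ℝ) ≤ (c j ⬝ᵥ z : ℤ) := by exact_mod_cast h
      linarith [(hvc j).2]
    · have : (-1 : ℝ) < (c j ⬝ᵥ z : ℤ) := (hvc j).1.trans_le h
      have : -1 < c j ⬝ᵥ z := by exact_mod_cast this
      change 0 ≤ c j ⬝ᵥ z
      omega
  have hU : IsStable (coneSemigroup c) (coneSemigroup c : Set (ι → ℤ)) :=
    fun a ha z hz => (coneSemigroup c).add_mem ha hz
  have hV : IsStable (coneSemigroup c) (∅ : Set (ι → ℤ)) := fun a ha z hz => hz.elim
  have key := depthOn_of_cell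
    (residueModule m)
    (fun x hx => mem_annihilator_residueModule (hm x hx))
    (fun x => (exists_aeval_mem_of_isMaximal m (monomialOf k x)).imp
      fun p hp => ⟨hp.1, mem_annihilator_residueModule hp.2⟩)
    (Fintype.card ι) ⊤ (by rw [finrank_top, Module.finrank_fintype_fun_eq_card]) v hv _ _
    (Set.empty_subset _) hcell hU hV
  let f : Subquotient (supportedIn k _ hU) (supportedIn k _ hV) →ₗ[
      monoidSubalgebra k (coneSemigroup c)] monoidSubalgebra k (coneSemigroup c) :=
    Submodule.liftQ _
      { toFun := fun g => ⟨g.1, g.2⟩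
        map_add' := fun _ _ => rfl
        map_smul' := fun _ _ => rfl } (by
        intro g hg
        have : (g : k[ι → ℤ]) = 0 := by
          ext z
          by_contra h
          exact (Set.notMem_empty z) (hg z h)
        exact Subtype.ext this)
  refine DepthGE.congr (LinearEquiv.ofBijective f ⟨?_, ?_⟩) key
  · rw [injective_iff_map_eq_zero]
    intro g hg
    obtain ⟨g, rfl⟩ := Submodule.mkQ_surjective _ g
    have h0 : (g : k[ι → ℤ]) = 0 := congrArg Subtype.val hg
    rw [Submodule.mkQ_apply, Submodule.Quotient.mk_eq_zero]
    change (g : k[ι → ℤ]) ∈ supportedIn k _ hV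
    rw [h0]
    exact Submodule.zero_mem _
  · intro g
    exact ⟨Submodule.Quotient.mk ⟨g.1, g.2⟩, rfl⟩

/-- If `m` contains all noninvertible monomials, then the algebra of the lattice points of a
full-dimensional cone has a regular sequence in `m` whose length is the rank of the lattice. -/
lemma exists_isRegular (x₀ : ι → ℤ) (hx₀ : ∀ j, 0 < c j ⬝ᵥ x₀)
    [Algebra.FiniteType k (monoidSubalgebra k (coneSemigroup c))]
    (m : Ideal (monoidSubalgebra k (coneSemigroup c))) [hmax : m.IsMaximal]
    (hm : ∀ x : coneSemigroup c, (∃ j, 0 < c j ⬝ᵥ (x : ι → ℤ)) → monomialOf k x ∈ m) :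
    ∃ rs : List (monoidSubalgebra k (coneSemigroup c)), rs.length = Fintype.card ι ∧
      (∀ r ∈ rs, r ∈ m) ∧
      RingTheory.Sequence.IsRegular (monoidSubalgebra k (coneSemigroup c)) rs := by
  have : IsNoetherianRing (monoidSubalgebra k (coneSemigroup c)) :=
    Algebra.FiniteType.isNoetherianRing k _
  exact (depthGE_quotient x₀ hx₀ m hm).exists_isRegular

end RegularSequence

/-! ### Localization at a maximal ideal -/

section Localization

lemma isRegular_map_ringEquiv {R S : Type*} [CommRing R] [CommRing S] (e : R ≃+* S) {rs : List R}
    (h : RingTheory.Sequence.IsRegular R rs) : RingTheory.Sequence.IsRegular S (rs.map e) := by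
  have := RingHomInvPair.of_ringEquiv e
  have := RingHomInvPair.of_ringEquiv e.symm
  let f : R ≃ₛₗ[(e : R →+* S)] S :=
    { e.toAddEquiv with map_smul' := fun r x => map_mul e r x }
  exact (LinearEquiv.isRegular_congr' f rs).1 h

lemma mem_maximalIdeal_of_ringEquiv {R S : Type*} [CommRing R] [CommRing S] [IsLocalRing R]
    [IsLocalRing S] (e : R ≃+* S) {r : R} (hr : r ∈ IsLocalRing.maximalIdeal R) :
    e r ∈ IsLocalRing.maximalIdeal S := by
  rw [IsLocalRing.mem_maximalIdeal, mem_nonunits_iff] at hr ⊢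
  rwa [MulEquiv.isUnit_map]

lemma isLocalization_away_of_injective {A B : Type*} [CommRing A] [CommRing B] [Algebra A B]
    (hf : Function.Injective (algebraMap A B)) {y : A} (hy : IsUnit (algebraMap A B y))
    (hs : ∀ b, ∃ (N : ℕ) (a : A), algebraMap A B a = b * algebraMap A B y ^ N) :
    IsLocalization.Away y B := by
  refine ⟨?_, ?_, ?_⟩
  · rintro ⟨_, N, rfl⟩
    change IsUnit (algebraMap A B (y ^ N))
    rw [map_pow]
    exact hy.pow N
  · intro b
    obtain ⟨N, a, ha⟩ := hs b
    refine ⟨(a, ⟨y ^ N, N, rfl⟩), ?_⟩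
    change b * algebraMap A B (y ^ N) = algebraMap A B a
    rw [map_pow, ha]
  · intro a b hab
    exact ⟨1, by rw [hf hab]⟩

/-- A regular sequence in the maximal ideal of the localization of `A` at `m` may be found in a
localization `B` of `A` away from one element outside of `m`. -/
lemma exists_isRegular_atPrime_of_away {k A B : Type*} [Field k] [CommRing A] [CommRing B]
    [Algebra k A] [Algebra.FiniteType k A] [Algebra k B] (f : A →ₐ[k] B)
    (hf : Function.Injective f) {y : A} (hy : IsUnit (f y))
    (hs : ∀ b, ∃ (N : ℕ) (a : A), f a = b * f y ^ N) (m : Ideal A) [m.IsMaximal] (hym : y ∉ m)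
    {n : ℕ} (h : Algebra.FiniteType k B → ∀ m' : Ideal B, m'.IsMaximal → m'.comap f = m →
      ∃ rs : List B, rs.length = n ∧ (∀ r ∈ rs, r ∈ m') ∧ RingTheory.Sequence.IsRegular B rs) :
    ∃ rs : List (Localization.AtPrime m), rs.length = n ∧
      (∀ r ∈ rs, r ∈ IsLocalRing.maximalIdeal (Localization.AtPrime m)) ∧
      RingTheory.Sequence.IsRegular (Localization.AtPrime m) rs := by
  let := f.toRingHom.toAlgebra
  have : IsScalarTower k A B := IsScalarTower.of_algHom f
  have hloc : IsLocalization.Away y B := isLocalization_away_of_injective hf hy hs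
  have hfin : Algebra.FiniteType k B :=
    Algebra.FiniteType.trans (S := A) inferInstance
      (IsLocalization.finiteType_of_monoid_fg (Submonoid.powers y) B)
  have hJ : IsJacobsonRing A := isJacobsonRing_of_finiteType (A := k)
  have hm' : (m.map (algebraMap A B)).IsMaximal :=
    IsLocalization.isMaximal_of_isMaximal_disjoint y m inferInstance hym
  set m' := m.map (algebraMap A B) with hm'def
  have hcomap : m'.comap (algebraMap A B) = m :=
    IsLocalization.under_map_of_isPrime_disjoint (Submonoid.powers y) B (Ideal.IsMaximal.isPrime ‹_›)
      ((Ideal.disjoint_powers_iff_notMem_of_isPrime y).2 hym)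
  obtain ⟨rs, hlen, hmem, hreg⟩ := h hfin m' hm' hcomap
  have hat : IsLocalization.AtPrime (Localization.AtPrime m') (m'.comap (algebraMap A B)) :=
    IsLocalization.isLocalization_isLocalization_atPrime_isLocalization (Submonoid.powers y) _ m'
  have hat' : IsLocalization m.primeCompl (Localization.AtPrime m') := by
    have : (m'.comap (algebraMap A B)).primeCompl = m.primeCompl := by
      ext x
      simp only [Ideal.mem_primeCompl_iff, hcomap]
    rw [← this]
    exact hat
  have e : Localization.AtPrime m' ≃+* Localization.AtPrime m :=
    (IsLocalization.algEquiv m.primeCompl (Localization.AtPrime m')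
      (Localization.AtPrime m)).toRingEquiv
  refine ⟨(rs.map (algebraMap B (Localization.AtPrime m'))).map e, by simpa using hlen, ?_,
    isRegular_map_ringEquiv e
      (hreg.toIsWeaklyRegular.isRegular_of_isLocalization_of_mem _ m' hmem)⟩
  intro r hr
  obtain ⟨_, hx, rfl⟩ := List.mem_map.1 hr
  obtain ⟨b, hb, rfl⟩ := List.mem_map.1 hx
  exact mem_maximalIdeal_of_ringEquiv e
    ((IsLocalization.AtPrime.to_map_mem_maximal_iff _ m' b).2 (hmem b hb))

variable {k : Type u} [Field k] {ι : Type v} [Fintype ι] {J : Type*} [Finite J] {c : J → ι → ℤ}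

lemma exists_nat_smul_add_nonneg {P : J → Prop} {x y : ι → ℤ} (h : ∀ j, ¬ P j → 0 < c j ⬝ᵥ y)
    (h' : ∀ j, P j → 0 ≤ c j ⬝ᵥ x ∧ 0 ≤ c j ⬝ᵥ y) :
    ∃ N : ℕ, ∀ j, 0 ≤ c j ⬝ᵥ (x + N • y) := by
  have := Fintype.ofFinite J
  refine ⟨∑ j, (c j ⬝ᵥ x).natAbs, fun j => ?_⟩
  rw [dotProduct_add, dotProduct_smul, nsmul_eq_mul]
  have h1 : ((c j ⬝ᵥ x).natAbs : ℤ) ≤ (∑ j, (c j ⬝ᵥ x).natAbs : ℕ) := by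
    exact_mod_cast Finset.single_le_sum (f := fun j => (c j ⬝ᵥ x).natAbs) (fun _ _ => Nat.zero_le _)
      (Finset.mem_univ j)
  by_cases hj : P j
  · have := h' j hj
    have := mul_nonneg (Int.natCast_nonneg (∑ j, (c j ⬝ᵥ x).natAbs)) this.2
    omega
  · have := h j hj
    have h2 : ((c j ⬝ᵥ x).natAbs : ℤ) ≤ (∑ j, (c j ⬝ᵥ x).natAbs : ℕ) * (c j ⬝ᵥ y) := by
      nlinarith
    omega

/-- Every localization at a maximal ideal of the algebra of the lattice points of a
full-dimensional cone has a regular sequence whose length is the rank of the lattice. The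
inequalities that are strict at some monomial outside of the ideal may be dropped, since that
monomial becomes invertible. -/
lemma exists_isRegular_localization (x₀ : ι → ℤ) (hx₀ : ∀ j, 0 < c j ⬝ᵥ x₀)
    [Algebra.FiniteType k (monoidSubalgebra k (coneSemigroup c))]
    (m : Ideal (monoidSubalgebra k (coneSemigroup c))) [hmax : m.IsMaximal] :
    ∃ rs : List (Localization.AtPrime m), rs.length = Fintype.card ι ∧
      (∀ r ∈ rs, r ∈ IsLocalRing.maximalIdeal (Localization.AtPrime m)) ∧
      RingTheory.Sequence.IsRegular (Localization.AtPrime m) rs := by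
  classical
  have := Fintype.ofFinite J
  -- The inequalities that are equalities on all monomials outside of `m`.
  let P : J → Prop := fun j => ∀ x : coneSemigroup c, monomialOf k x ∉ m → c j ⬝ᵥ (x : ι → ℤ) = 0
  have hw : ∀ j, ∃ x : coneSemigroup c, monomialOf k x ∉ m ∧ (¬ P j → 0 < c j ⬝ᵥ (x : ι → ℤ)) := by
    intro j
    by_cases hj : P j
    · exact ⟨0, by
        rw [monomialOf_zero]
        exact fun h => hmax.ne_top ((Ideal.eq_top_iff_one m).2 h), fun h => absurd hj h⟩
    · simp only [P, not_forall] at hj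
      obtain ⟨x, hx, h0⟩ := hj
      exact ⟨x, hx, fun _ => lt_of_le_of_ne (x.2 j) (Ne.symm h0)⟩
  choose w hw hwpos using hw
  -- A monomial outside of `m` at which all the other inequalities are strict.
  set y : coneSemigroup c := ∑ j, w j with hydef
  have hym : monomialOf k y ∉ m := by
    have : ∀ s : Finset J, monomialOf k (∑ j ∈ s, w j) ∉ m := by
      intro s
      induction s using Finset.induction_on with
      | empty =>
        rw [Finset.sum_empty, monomialOf_zero]
        exact fun h => hmax.ne_top ((Ideal.eq_top_iff_one m).2 h)
      | insert a s ha ih =>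
        rw [Finset.sum_insert ha, monomialOf_add]
        exact fun h => (hmax.isPrime.mem_or_mem h).elim (hw a) ih
    exact this _
  have hypos : ∀ j, ¬ P j → 0 < c j ⬝ᵥ (y : ι → ℤ) := by
    intro j hj
    have : c j ⬝ᵥ (y : ι → ℤ) = ∑ i, c j ⬝ᵥ (w i : ι → ℤ) := by
      rw [hydef, AddSubmonoid.coe_finsetSum, dotProduct_sum]
    rw [this]
    exact Finset.sum_pos' (fun i _ => (w i).2 j) ⟨j, Finset.mem_univ j, hwpos j hj⟩
  have hyzero : ∀ j, P j → c j ⬝ᵥ (y : ι → ℤ) = 0 := fun j hj => hj y hym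
  let c' : {j // P j} → ι → ℤ := fun j => c j
  have hle : coneSemigroup c ≤ coneSemigroup c' := fun z hz j => hz j
  have hsub : monoidSubalgebra k (coneSemigroup c) ≤ monoidSubalgebra k (coneSemigroup c') :=
    fun f hf z hz => hle (hf z hz)
  have hshift : ∀ x ∈ coneSemigroup c', ∃ N : ℕ, ∀ N', N ≤ N' → x + N' • (y : ι → ℤ) ∈
      coneSemigroup c := by
    intro x hx
    obtain ⟨N, hN⟩ := exists_nat_smul_add_nonneg (c := c) (P := P) (x := x) hypos
      (fun j hj => ⟨hx ⟨j, hj⟩, y.2 j⟩)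
    refine ⟨N, fun N' hN' => ?_⟩
    obtain ⟨d, rfl⟩ := Nat.exists_eq_add_of_le hN'
    rw [add_nsmul, ← add_assoc]
    exact (coneSemigroup c).add_mem hN ((coneSemigroup c).nsmul_mem y.2 d)
  have hmono : ∀ x : coneSemigroup c, Subalgebra.inclusion hsub (monomialOf k x) =
      monomialOf k (⟨x, hle x.2⟩ : coneSemigroup c') := fun x => rfl
  have hyneg : -(y : ι → ℤ) ∈ coneSemigroup c' := by
    intro j
    rw [dotProduct_neg, hyzero j j.2, neg_zero]
  refine exists_isRegular_atPrime_of_away (Subalgebra.inclusion hsub)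
    (Subalgebra.inclusion_injective hsub) (y := monomialOf k y) ?_ ?_ m hym ?_
  · refine IsUnit.of_mul_eq_one (monomialOf k (⟨-y, hyneg⟩ : coneSemigroup c')) ?_
    rw [hmono, ← monomialOf_add, ← monomialOf_zero]
    congr 1
    exact Subtype.ext (add_neg_cancel _)
  · intro b
    choose! N hN using hshift
    refine ⟨∑ z ∈ (b : k[ι → ℤ]).coeff.support, N z,
      ⟨(b : k[ι → ℤ]) *
        single ((∑ z ∈ (b : k[ι → ℤ]).coeff.support, N z) • (y : ι → ℤ)) 1, ?_⟩, ?_⟩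
    · intro z hz
      rw [mul_comm, coeff_single_mul_apply, one_mul] at hz
      have h1 := hN _ (b.2 _ hz) (∑ z ∈ (b : k[ι → ℤ]).coeff.support, N z)
        (Finset.single_le_sum (f := N) (fun _ _ => Nat.zero_le _) (Finsupp.mem_support_iff.2 hz))
      rwa [neg_add_eq_sub, sub_add_cancel] at h1
    · apply Subtype.ext
      rw [hmono, ← monomialOf_nsmul]
      rfl
  · intro hfin m' hm' hcomap
    refine exists_isRegular (c := c') x₀ (fun j => hx₀ j) m' ?_
    rintro x ⟨j, hj⟩
    obtain ⟨N, hN⟩ := hshift x x.2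
    have h1 : monomialOf k (⟨x + N • (y : ι → ℤ), hN N le_rfl⟩ : coneSemigroup c) ∈ m := by
      by_contra h
      have h2 := j.2 _ h
      change c j ⬝ᵥ ((x : ι → ℤ) + N • (y : ι → ℤ)) = 0 at h2
      rw [dotProduct_add, dotProduct_smul, hyzero j j.2, smul_zero, add_zero] at h2
      exact hj.ne' h2
    rw [← hcomap, Ideal.mem_comap] at h1
    have h2 : Subalgebra.inclusion hsub
        (monomialOf k (⟨x + N • (y : ι → ℤ), hN N le_rfl⟩ : coneSemigroup c)) =
        monomialOf k x * Subalgebra.inclusion hsub (monomialOf k y) ^ N := by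
      rw [hmono, hmono, ← monomialOf_nsmul, ← monomialOf_add]
      rfl
    have h1' : Subalgebra.inclusion hsub
        (monomialOf k (⟨x + N • (y : ι → ℤ), hN N le_rfl⟩ : coneSemigroup c)) ∈ m' := h1
    rw [h2] at h1'
    refine (hm'.isPrime.mem_or_mem h1').resolve_right fun h3 => hym ?_
    rw [← hcomap]
    exact hm'.isPrime.mem_of_pow_mem _ h3

end Localization

/-! ### Laurent polynomials -/

section LaurentPolynomials

variable (k : Type u) [Field k] (ι : Type v)

/-- The inclusion of the exponents of polynomials in those of Laurent polynomials. -/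
def natExponents : (ι →₀ ℕ) →+ (ι → ℤ) where
  toFun a i := a i
  map_zero' := by ext; simp
  map_add' a b := by ext; simp

/-- The inclusion of the polynomials in the Laurent polynomials. -/
noncomputable def toLaurent : MvPolynomial ι k →ₐ[k] k[ι → ℤ] :=
  AddMonoidAlgebra.mapDomainAlgHom k k (natExponents ι)

lemma toLaurent_single (a : ι →₀ ℕ) (r : k) :
    toLaurent k ι (single a r) = single (natExponents ι a) r := by
  simp [toLaurent]

lemma toLaurent_injective : Function.Injective (toLaurent k ι) := by
  have : Function.Injective (natExponents ι) := fun a b h => by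
    ext i
    exact Int.ofNat_inj.1 (congrFun h i)
  exact AddMonoidAlgebra.mapDomain_injective this

variable [Fintype ι]

/-- The Laurent polynomials are the localization of the polynomials at the product of the
variables. -/
lemma exists_isLocalization_laurent : ∃ y : MvPolynomial ι k, y ≠ 0 ∧
    @IsLocalization _ _ (Submonoid.powers y) k[ι → ℤ] _ (toLaurent k ι).toRingHom.toAlgebra := by
  let := (toLaurent k ι).toRingHom.toAlgebra
  set u : ι →₀ ℕ := Finsupp.equivFunOnFinite.symm 1 with hu
  have hu' : natExponents ι u = 1 := by
    ext i
    simp [natExponents, hu]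
  refine ⟨single u 1, ?_, isLocalization_away_of_injective (toLaurent_injective k ι) ?_ ?_⟩
  · rw [Ne, AddMonoidAlgebra.single_eq_zero]
    exact one_ne_zero
  · change IsUnit (toLaurent k ι (single u 1))
    rw [toLaurent_single, hu']
    refine IsUnit.of_mul_eq_one (single (-1) 1) ?_
    rw [single_mul_single, one_mul, one_def, add_neg_cancel]
  · change ∀ b, ∃ (N : ℕ) (a : MvPolynomial ι k), toLaurent k ι a = b * toLaurent k ι (single u 1) ^ N
    intro b
    induction b using AddMonoidAlgebra.induction_linear with
    | zero => exact ⟨0, 0, by simp⟩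
    | add x y hx hy =>
      obtain ⟨N, a, ha⟩ := hx
      obtain ⟨N', a', ha'⟩ := hy
      refine ⟨N + N', a * single u 1 ^ N' + a' * single u 1 ^ N, ?_⟩
      rw [map_add, map_mul, map_mul, map_pow, map_pow, ha, ha']
      ring
    | single z r =>
      refine ⟨∑ i, (z i).natAbs, single (Finsupp.equivFunOnFinite.symm
        fun i => (z i + ∑ i, ((z i).natAbs : ℤ)).toNat) r, ?_⟩
      rw [toLaurent_single, toLaurent_single, hu', single_pow, single_mul_single, one_pow, mul_one]
      congr 1
      ext i
      have : ((z i).natAbs : ℤ) ≤ ∑ i, ((z i).natAbs : ℤ) :=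
        Finset.single_le_sum (f := fun i => ((z i).natAbs : ℤ)) (fun _ _ => Int.natCast_nonneg _)
          (Finset.mem_univ i)
      change ((z i + ∑ i, ((z i).natAbs : ℤ)).toNat : ℤ) = z i + (∑ i, (z i).natAbs) • (1 : ℤ)
      rw [nsmul_eq_mul, mul_one, Nat.cast_sum]
      omega

lemma isIntegrallyClosed_laurent : IsIntegrallyClosed k[ι → ℤ] := by
  let := (toLaurent k ι).toRingHom.toAlgebra
  obtain ⟨y, hy, hloc⟩ := exists_isLocalization_laurent k ι
  exact isIntegrallyClosed_of_isLocalization (R := MvPolynomial ι k) _ (Submonoid.powers y)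
    (powers_le_nonZeroDivisors_of_noZeroDivisors hy)

lemma card_le_of_algebraicIndependent_laurent {s : ℕ} {x : Fin s → k[ι → ℤ]}
    (hx : AlgebraicIndependent k x) : s ≤ Fintype.card ι := by
  let := (toLaurent k ι).toRingHom.toAlgebra
  obtain ⟨y, hy, hloc⟩ := exists_isLocalization_laurent k ι
  have : IsScalarTower k (MvPolynomial ι k) k[ι → ℤ] := IsScalarTower.of_algHom (toLaurent k ι)
  have halg : Algebra.IsAlgebraic (MvPolynomial ι k) k[ι → ℤ] :=
    IsLocalization.isAlgebraic (R := MvPolynomial ι k) (S := k[ι → ℤ]) (M := Submonoid.powers y)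
  have : FaithfulSMul (MvPolynomial ι k) k[ι → ℤ] :=
    (faithfulSMul_iff_algebraMap_injective _ _).2 (toLaurent_injective k ι)
  have h1 := lift_trdeg_add_eq k (MvPolynomial ι k) k[ι → ℤ]
  rw [trdeg_eq_zero (R := MvPolynomial ι k) (A := k[ι → ℤ])] at h1
  have h2 := hx.lift_cardinalMk_le_trdeg
  simp at h1 h2
  rw [← h1] at h2
  simpa using h2

end LaurentPolynomials

/-! ### The upper bound for the dimension -/

section Dimension

variable {k : Type u} [Field k] {ι : Type v} [Fintype ι]

lemma ringKrullDim_le_of_isIntegral {A B : Type*} [CommRing A] [CommRing B] (f : A →+* B)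
    (hf : f.IsIntegral) : ringKrullDim B ≤ ringKrullDim A := by
  let := f.toAlgebra
  have : Algebra.IsIntegral A B := ⟨hf⟩
  refine Order.krullDim_le_of_strictMono (PrimeSpectrum.comap (algebraMap A B)) ?_
  intro p q hpq
  exact Ideal.IsIntegral.comap_lt_comap hpq

/-- By Noether normalization, the dimension of an algebra of Laurent polynomials is the number of
elements of some algebraically independent family. -/
lemma ringKrullDim_le_card {R : Type*} [CommRing R] [Algebra k R] [Algebra.FiniteType k R]
    (f : R →ₐ[k] k[ι → ℤ]) (hf : Function.Injective f) : ringKrullDim R ≤ Fintype.card ι := by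
  have : Nontrivial R := f.toRingHom.domain_nontrivial
  obtain ⟨s, g, hg, hint⟩ := exists_integral_inj_algHom_of_fg k R
  refine (ringKrullDim_le_of_isIntegral g.toRingHom hint).trans ?_
  rw [MvPolynomial.ringKrullDim_of_isNoetherianRing, ringKrullDim_eq_zero_of_field, zero_add,
    Nat.card_fin]
  have h : AlgebraicIndependent k fun i => f (g (MvPolynomial.X i)) := by
    rw [algebraicIndependent_iff_injective_aeval]
    have : MvPolynomial.aeval (fun i => f (g (MvPolynomial.X i))) = f.comp g := by
      ext i
      simp
    rw [this]
    exact hf.comp hg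
  exact_mod_cast card_le_of_algebraicIndependent_laurent k ι h

end Dimension

/-! ### Normality of algebras of cones -/

section Normality

variable {k : Type u} [Field k] {L : Type v} [AddCommGroup L]

lemma le_of_coeff_mul_ne_zero (l : L →+ ℤ) {a b : ℤ} {f g : k[L]}
    (hf : ∀ z, f.coeff z ≠ 0 → a ≤ l z) (hg : ∀ z, g.coeff z ≠ 0 → b ≤ l z) :
    ∀ z, (f * g).coeff z ≠ 0 → a + b ≤ l z := by
  classical
  intro z hz
  obtain ⟨x, hx, y, hy, rfl⟩ :=
    Finset.mem_add.1 (support_coeff_mul_subset f g (Finsupp.mem_support_iff.2 hz))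
  rw [map_add]
  exact add_le_add (hf x (Finsupp.mem_support_iff.1 hx)) (hg y (Finsupp.mem_support_iff.1 hy))

lemma component_eq_zero (l : L →+ ℤ) {a : ℤ} {f : k[L]}
    (hf : ∀ z, f.coeff z ≠ 0 → a + 1 ≤ l z) : component l a f = 0 := by
  ext z
  rw [component_coeff]
  split_ifs with h
  · by_contra hz
    have := hf z hz
    omega
  · rfl

/-- The component of lowest possible degree of a product is the product of those of the factors. -/
lemma component_mul (l : L →+ ℤ) {a b : ℤ} {f g : k[L]} (hf : ∀ z, f.coeff z ≠ 0 → a ≤ l z)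
    (hg : ∀ z, g.coeff z ≠ 0 → b ≤ l z) :
    component l (a + b) (f * g) = component l a f * component l b g := by
  classical
  have hcomp : ∀ (f : k[L]) (a : ℤ) z, (component l a f).coeff z ≠ 0 → l z = a := by
    intro f a z hz
    rw [component_coeff] at hz
    by_contra h
    exact hz (if_neg h)
  have hrest : ∀ (f : k[L]) (a : ℤ), (∀ z, f.coeff z ≠ 0 → a ≤ l z) →
      ∀ z, (f - component l a f).coeff z ≠ 0 → a + 1 ≤ l z := by
    intro f a hf z hz
    rw [coeff_sub, Finsupp.sub_apply, component_coeff] at hz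
    split_ifs at hz with h
    · exact absurd (sub_self _) hz
    · rw [sub_zero] at hz
      have := hf z hz
      omega
  set p := component l a f with hp
  set q := component l b g with hq
  have e : f * g = p * q + (p * (g - q) + (f - p) * g) := by ring
  have h1 : component l (a + b) (p * (g - q)) = 0 := component_eq_zero l fun z hz => by
    have := le_of_coeff_mul_ne_zero l (fun z hz => (hcomp f a z hz).ge) (hrest g b hg) z hz
    omega
  have h2 : component l (a + b) ((f - p) * g) = 0 := component_eq_zero l fun z hz => by
    have := le_of_coeff_mul_ne_zero l (hrest f a hf) hg z hz
    omega
  rw [e, map_add, map_add, h1, h2, add_zero, add_zero]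
  ext z
  rw [component_coeff]
  split_ifs with h
  · rfl
  · by_contra hz
    obtain ⟨x, hx, y, hy, rfl⟩ :=
      Finset.mem_add.1 (support_coeff_mul_subset p q (Finsupp.mem_support_iff.2 (Ne.symm hz)))
    rw [map_add, hcomp f a x (Finsupp.mem_support_iff.1 hx),
      hcomp g b y (Finsupp.mem_support_iff.1 hy)] at h
    exact h rfl

lemma component_pow (l : L →+ ℤ) {a : ℤ} {f : k[L]} (hf : ∀ z, f.coeff z ≠ 0 → a ≤ l z) (n : ℕ) :
    (∀ z, (f ^ n).coeff z ≠ 0 → n * a ≤ l z) ∧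
      component l (n * a) (f ^ n) = component l a f ^ n := by
  classical
  have hone : ∀ z, (1 : k[L]).coeff z ≠ 0 → l z = 0 := by
    intro z hz
    rw [one_def, coeff_single, Finsupp.single_apply] at hz
    split_ifs at hz with h
    · rw [← h, map_zero]
    · exact absurd rfl hz
  induction n with
  | zero =>
    refine ⟨fun z hz => ?_, ?_⟩
    · rw [pow_zero] at hz
      simp [hone z hz]
    · ext z
      rw [component_coeff, pow_zero, pow_zero]
      split_ifs with h
      · rfl
      · by_contra hz
        exact h (by simpa using hone z (Ne.symm hz))
  | succ n ih =>
    have e : ((n + 1 : ℕ) : ℤ) * a = n * a + a := by push_cast; ring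
    rw [e, pow_succ, pow_succ]
    exact ⟨le_of_coeff_mul_ne_zero l ih.1 hf, by rw [component_mul l ih.1 hf, ih.2]⟩

/-- A Laurent polynomial that is integral over a ring of Laurent polynomials of nonnegative degrees
has nonnegative degrees: otherwise its component of lowest degree would be nilpotent. -/
lemma nonneg_of_isIntegral [IsDomain k[L]] (l : L →+ ℤ) (R : Subalgebra k k[L])
    (hR : ∀ r ∈ R, ∀ z, r.coeff z ≠ 0 → 0 ≤ l z) {f : k[L]} (hf : IsIntegral R f) :
    ∀ z, f.coeff z ≠ 0 → 0 ≤ l z := by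
  intro z₀ hz₀
  obtain ⟨z₁, hz₁, hmin⟩ := f.coeff.support.exists_min_image l ⟨z₀, Finsupp.mem_support_iff.2 hz₀⟩
  have hmin' : ∀ z, f.coeff z ≠ 0 → l z₁ ≤ l z := fun z hz => hmin z (Finsupp.mem_support_iff.2 hz)
  refine le_trans ?_ (hmin' z₀ hz₀)
  by_contra! hneg
  obtain ⟨p, hp, hpf⟩ := hf
  rw [Polynomial.eval₂_eq_sum_range, Finset.sum_range_succ, hp.coeff_natDegree, map_one,
    one_mul] at hpf
  have h1 := congrArg (component l (p.natDegree * l z₁)) hpf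
  rw [map_add, map_sum, map_zero, (component_pow l hmin' _).2, Finset.sum_eq_zero, zero_add] at h1
  · have h2 := congrArg (fun g : k[L] => g.coeff z₁) (eq_zero_of_pow_eq_zero h1)
    simp only [component_coeff, if_true] at h2
    exact Finsupp.mem_support_iff.1 hz₁ h2
  · intro i hi
    refine component_eq_zero l fun z hz => ?_
    have h2 := le_of_coeff_mul_ne_zero l (hR _ (p.coeff i).2) (component_pow l hmin' i).1 z hz
    have h3 : (i : ℤ) + 1 ≤ p.natDegree := by exact_mod_cast Finset.mem_range.1 hi
    nlinarith

/-- The algebra of a cone is integrally closed in the normal ring of Laurent polynomials, by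
`nonneg_of_isIntegral` for each of the inequalities. -/
lemma isIntegrallyClosed_coneSemigroup {ι : Type v} [Fintype ι] {J : Type*} (c : J → ι → ℤ) :
    IsIntegrallyClosed (monoidSubalgebra k (coneSemigroup c)) := by
  have := isIntegrallyClosed_laurent k ι
  have : IsIntegrallyClosedIn (monoidSubalgebra k (coneSemigroup c)) k[ι → ℤ] := by
    refine isIntegrallyClosedIn_iff.2 ⟨Subtype.val_injective, fun {f} hf => ⟨⟨f, ?_⟩, rfl⟩⟩
    intro z hz j
    exact nonneg_of_isIntegral (dotProductBilin ℤ ℤ (c j)).toAddMonoidHom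
      (monoidSubalgebra k (coneSemigroup c))
      (fun r hr z hz => hr z hz j) hf z hz
  exact IsIntegrallyClosed.of_isIntegrallyClosed_of_isIntegrallyClosedIn _ k[ι → ℤ]

end Normality

/-! ### The Cohen–Macaulay property of algebras of cones -/

section CohenMacaulay

lemma IsCohenMacaulayLocal.of_ringEquiv {R S : Type*} [CommRing R] [CommRing S] [IsLocalRing R]
    [IsLocalRing S] (e : R ≃+* S) (h : IsCohenMacaulayLocal R) : IsCohenMacaulayLocal S := by
  obtain ⟨rs, hmem, hreg, hdim⟩ := h
  refine ⟨rs.map e, ?_, isRegular_map_ringEquiv e hreg, ?_⟩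
  · intro r hr
    obtain ⟨x, hx, rfl⟩ := List.mem_map.1 hr
    exact mem_maximalIdeal_of_ringEquiv e (hmem x hx)
  · rw [List.length_map, hdim, ringKrullDim_eq_of_ringEquiv e]

lemma IsCohenMacaulayRing.of_ringEquiv {R S : Type*} [CommRing R] [CommRing S]
    (e : R ≃+* S) (h : IsCohenMacaulayRing R) : IsCohenMacaulayRing S := by
  have := h.1
  refine ⟨isNoetherianRing_of_ringEquiv R e, fun m hm => ?_⟩
  have : (m.comap e).IsMaximal := Ideal.comap_isMaximal_of_equiv e
  exact (h.2 (m.comap e)).of_ringEquiv (IsLocalization.ringEquivOfRingEquiv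
    (Localization.AtPrime (m.comap e)) (Localization.AtPrime m) e (e.map_primeCompl_comap_eq m))

/-- A regular sequence never exceeds the dimension, so one that reaches an upper bound for the
dimension has the right length. -/
lemma isCohenMacaulayLocal_of_ringKrullDim_le {R : Type*} [CommRing R] [IsLocalRing R]
    [IsNoetherianRing R] {rs : List R} (hmem : ∀ r ∈ rs, r ∈ IsLocalRing.maximalIdeal R)
    (hreg : RingTheory.Sequence.IsRegular R rs) (hdim : ringKrullDim R ≤ rs.length) :
    IsCohenMacaulayLocal R := by
  refine ⟨rs, hmem, hreg, le_antisymm ?_ hdim⟩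
  rw [← ringKrullDim_add_length_eq_ringKrullDim_of_isRegular rs hreg]
  have : Nontrivial (R ⧸ Ideal.ofList rs) := by
    refine Ideal.Quotient.nontrivial_iff.2 fun h => (Ideal.ne_top_iff_one _).1
      (IsLocalRing.maximalIdeal.isMaximal R).ne_top ?_
    have h1 : Ideal.ofList rs ≤ IsLocalRing.maximalIdeal R := Ideal.span_le.2 hmem
    exact h1 (h ▸ Submodule.mem_top)
  exact le_add_of_nonneg_left ringKrullDim_nonneg_of_nontrivial

variable {k : Type u} [Field k] {ι : Type v} [Fintype ι] {J : Type*} [Finite J] {c : J → ι → ℤ}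

/-- The algebra of the lattice points of a full-dimensional rational cone is Cohen–Macaulay. -/
lemma isCohenMacaulayRing_coneSemigroup (x₀ : ι → ℤ) (hx₀ : ∀ j, 0 < c j ⬝ᵥ x₀)
    [Algebra.FiniteType k (monoidSubalgebra k (coneSemigroup c))] :
    IsCohenMacaulayRing (monoidSubalgebra k (coneSemigroup c)) := by
  have hN : IsNoetherianRing (monoidSubalgebra k (coneSemigroup c)) :=
    Algebra.FiniteType.isNoetherianRing k _
  refine ⟨hN, fun m hm => ?_⟩
  obtain ⟨rs, hlen, hmem, hreg⟩ := exists_isRegular_localization x₀ hx₀ m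
  refine isCohenMacaulayLocal_of_ringKrullDim_le hmem hreg ?_
  rw [hlen]
  refine le_trans ?_ (ringKrullDim_le_card (monoidSubalgebra k (coneSemigroup c)).val
    Subtype.val_injective)
  rw [IsLocalization.AtPrime.ringKrullDim_eq_height m]
  exact Ideal.height_le_ringKrullDim_of_ne_top hm.ne_top

end CohenMacaulay

/-! ### Presentations of monoid algebras -/

section Presentation

variable (k : Type u) [Field k] {L : Type v} [AddCommGroup L]

lemma eq_sum_single {k L : Type*} [Semiring k] (f : k[L]) :
    f = ∑ z ∈ f.coeff.support, single z (f.coeff z) := by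
  apply coeff_injective
  rw [coeff_sum]
  exact (Finsupp.sum_single f.coeff).symm

/-- The algebra of a submonoid as a subalgebra of the group algebra. -/
noncomputable def monoidSubalgebraEquiv (M : AddSubmonoid L) : k[M] ≃ₐ[k] monoidSubalgebra k M := by
  have hinj : Function.Injective (AddMonoidAlgebra.mapDomainAlgHom k k M.subtype) :=
    AddMonoidAlgebra.mapDomain_injective Subtype.val_injective
  refine (AlgEquiv.ofInjective _ hinj).trans (Subalgebra.equivOfEq _ _ (le_antisymm ?_ ?_))
  · rintro _ ⟨f, rfl⟩
    change AddMonoidAlgebra.mapDomainAlgHom k k M.subtype f ∈ _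
    induction f using AddMonoidAlgebra.induction_linear with
    | zero => rw [map_zero]; exact Subalgebra.zero_mem _
    | add f g hf hg => rw [map_add]; exact Subalgebra.add_mem _ hf hg
    | single x r =>
      rw [mapDomainAlgHom_apply, mapDomain_single]
      exact single_mem_monoidSubalgebra x.2 r
  · intro f hf
    rw [eq_sum_single f]
    refine Subalgebra.sum_mem _ fun z hz =>
      ⟨single ⟨z, hf z (Finsupp.mem_support_iff.1 hz)⟩ (f.coeff z), ?_⟩
    change AddMonoidAlgebra.mapDomainAlgHom k k M.subtype (single _ _) = _
    rw [mapDomainAlgHom_apply, mapDomain_single]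
    rfl

lemma range_aeval_single (A : Set L) :
    (MvPolynomial.aeval (R := k) (fun a : A => (single (a : L) 1 : k[L]))).range =
      monoidSubalgebra k (AddSubmonoid.closure A) := by
  apply le_antisymm
  · rw [← Algebra.adjoin_range_eq_range_aeval, Algebra.adjoin_le_iff]
    rintro _ ⟨a, rfl⟩
    exact single_mem_monoidSubalgebra (AddSubmonoid.subset_closure a.2) 1
  · have key : ∀ x ∈ AddSubmonoid.closure A, (single x 1 : k[L]) ∈
        (MvPolynomial.aeval (R := k) (fun a : A => (single (a : L) 1 : k[L]))).range := by
      intro x hx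
      induction hx using AddSubmonoid.closure_induction with
      | mem x hx => exact ⟨MvPolynomial.X ⟨x, hx⟩, MvPolynomial.aeval_X _ _⟩
      | zero => exact Subalgebra.one_mem _
      | add x y _ _ hx hy =>
        have := Subalgebra.mul_mem _ hx hy
        rwa [single_mul_single, one_mul] at this
    intro f hf
    rw [eq_sum_single f]
    refine Subalgebra.sum_mem _ fun z hz => ?_
    have := Subalgebra.smul_mem _ (key z (hf z (Finsupp.mem_support_iff.1 hz))) (f.coeff z)
    rwa [smul_single, smul_eq_mul, mul_one] at this

lemma finiteType_monoidSubalgebra {A : Set L} (hA : A.Finite) :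
    Algebra.FiniteType k (monoidSubalgebra k (AddSubmonoid.closure A)) := by
  have := hA.to_subtype
  rw [← range_aeval_single]
  exact Algebra.FiniteType.of_surjective
    (MvPolynomial.aeval (R := k) (fun a : A => (single (a : L) 1 : k[L]))).rangeRestrict
    (AlgHom.rangeRestrict_surjective _)

variable {ι : Type v} [Fintype ι] {J : Type*} {c : J → ι → ℤ}

lemma isDomain_and_isIntegrallyClosed {M : AddSubmonoid (ι → ℤ)} (hM : M = coneSemigroup c) :
    IsDomain k[M] ∧ IsIntegrallyClosed k[M] := by
  have h1 := isIntegrallyClosed_coneSemigroup (k := k) c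
  rw [← hM] at h1
  exact ⟨(monoidSubalgebraEquiv k M).injective.isDomain (monoidSubalgebraEquiv k M).toAlgHom,
    IsIntegrallyClosed.of_equiv (monoidSubalgebraEquiv k M).symm.toRingEquiv⟩

lemma isCohenMacaulayRing_quotient_toricIdeal [Finite J] {A : Set (ι → ℤ)} (hA : A.Finite)
    (hM : AddSubmonoid.closure A = coneSemigroup c) (x₀ : ι → ℤ) (hx₀ : ∀ j, 0 < c j ⬝ᵥ x₀) :
    IsCohenMacaulayRing (MvPolynomial A k ⧸ toricIdeal k A) := by
  have h1 := finiteType_monoidSubalgebra k hA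
  have h2 : IsCohenMacaulayRing (monoidSubalgebra k (AddSubmonoid.closure A)) := by
    rw [hM] at h1 ⊢
    exact isCohenMacaulayRing_coneSemigroup x₀ hx₀
  rw [← range_aeval_single] at h2
  exact h2.of_ringEquiv (RingHom.quotientKerEquivRange
    (MvPolynomial.aeval (R := k) (fun a : A => (single (a : ι → ℤ) 1 : k[ι → ℤ]))).toRingHom).symm

end Presentation

/-! ### Matroid rank functions and the covering theorem -/

section RankFunction

variable {E : Type*} [DecidableEq E]

/-- A matroid rank function on the subsets of a finite set. -/
structure IsRankFunction (r : Finset E → ℕ) : Prop where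
  empty : r ∅ = 0
  mono : ∀ {A B : Finset E}, A ⊆ B → r A ≤ r B
  insert_le : ∀ (e : E) (A : Finset E), r (insert e A) ≤ r A + 1
  submodular : ∀ A B : Finset E, r (A ∪ B) + r (A ∩ B) ≤ r A + r B

namespace IsRankFunction

variable {r : Finset E → ℕ}

lemma le_card (hr : IsRankFunction r) (A : Finset E) : r A ≤ A.card := by
  induction A using Finset.induction_on with
  | empty => simp [hr.empty]
  | insert e A he ih =>
    rw [Finset.card_insert_of_notMem he]
    exact (hr.insert_le e A).trans (by omega)

/-- If `e` depends on `A`, it depends on every set that contains `A`. -/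
lemma insert_le_of_subset (hr : IsRankFunction r) {A B : Finset E} (hAB : A ⊆ B) {e : E}
    (he : r (insert e A) ≤ r A) : r (insert e B) ≤ r B := by
  have h1 := hr.submodular B (insert e A)
  have h2 : B ∪ insert e A = insert e B := by
    rw [Finset.union_insert, Finset.union_eq_left.2 hAB]
  have h3 : r A ≤ r (B ∩ insert e A) :=
    hr.mono (Finset.subset_inter hAB (Finset.subset_insert e A))
  rw [h2] at h1
  omega

/-- The rank function of the contraction of an element that is not a loop. -/
lemma contract (hr : IsRankFunction r) {e : E} (he : 0 < r {e}) :
    IsRankFunction fun A => r (insert e A) - 1 := by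
  have hpos : ∀ A, 0 < r (insert e A) := fun A =>
    he.trans_le (hr.mono (Finset.singleton_subset_iff.2 (Finset.mem_insert_self e A)))
  refine ⟨?_, ?_, ?_, ?_⟩
  · have := hr.le_card (insert e ∅)
    simp at this ⊢
    omega
  · intro A B h
    exact Nat.sub_le_sub_right (hr.mono (Finset.insert_subset_insert e h)) 1
  · intro f A
    have := hr.insert_le f (insert e A)
    rw [Finset.insert_comm] at this
    have := hpos A
    omega
  · intro A B
    have h1 := hr.submodular (insert e A) (insert e B)
    rw [← Finset.insert_union_distrib, ← Finset.insert_inter_distrib] at h1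
    have := hpos A
    have := hpos B
    have := hpos (A ∪ B)
    have := hpos (A ∩ B)
    omega

/-- Every independent set is contained in a basis. -/
lemma exists_basis [Fintype E] (hr : IsRankFunction r) {I : Finset E} (hI : I.card ≤ r I) :
    ∃ S, I ⊆ S ∧ S.card = r S ∧ r S = r Finset.univ := by
  obtain ⟨S, hIS, hS⟩ := (Set.toFinite {S : Finset E | S.card ≤ r S}).exists_le_maximal hI
  refine ⟨S, hIS, le_antisymm hS.prop (hr.le_card S),
    le_antisymm (hr.mono (Finset.subset_univ S)) ?_⟩
  have hcl : ∀ e, r (insert e S) ≤ r S := by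
    intro e
    by_contra! h
    have h1 : (insert e S).card ≤ r (insert e S) := by
      have := Finset.card_insert_le e S
      have := hS.prop
      simp only [Set.mem_ofPred_eq] at this
      omega
    have h2 : insert e S ⊆ S := hS.le_of_ge h1 (Finset.subset_insert e S)
    rw [Finset.insert_eq_self.2 (h2 (Finset.mem_insert_self e S))] at h
    exact h.false
  have : ∀ X : Finset E, r (X ∪ S) ≤ r S := by
    intro X
    induction X using Finset.induction_on with
    | empty => simp
    | insert e X _ ih =>
      rw [Finset.insert_union]
      exact (hr.insert_le_of_subset Finset.subset_union_right (hcl e)).trans ih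
  exact (hr.mono Finset.subset_union_left).trans (this Finset.univ)

end IsRankFunction

variable {ι : Type*} [Fintype ι]

/-- By submodularity, sets on which the inequality `c(F) ≤ ∑ r_i(F)` is an equality are closed under
unions. -/
lemma exists_tight_biUnion {r : ι → Finset E → ℕ} (hr : ∀ i, IsRankFunction (r i)) {c : E → ℕ}
    (h : ∀ F, ∑ e ∈ F, c e ≤ ∑ i, r i F) (s : Finset ι) (F : ι → Finset E)
    (hF : ∀ i ∈ s, ∑ i', r i' (F i) ≤ ∑ e ∈ F i, c e) :
    ∑ i', r i' (s.biUnion F) ≤ ∑ e ∈ s.biUnion F, c e := by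
  classical
  induction s using Finset.induction_on with
  | empty => simp [(hr _).empty]
  | insert i s _ ih =>
    rw [Finset.biUnion_insert]
    have h1 := ih fun j hj => hF j (Finset.mem_insert_of_mem hj)
    have h2 := hF i (Finset.mem_insert_self i s)
    have h3 : ∑ i', r i' (F i ∪ s.biUnion F) + ∑ i', r i' (F i ∩ s.biUnion F) ≤
        ∑ i', r i' (F i) + ∑ i', r i' (s.biUnion F) := by
      rw [← Finset.sum_add_distrib, ← Finset.sum_add_distrib]
      exact Finset.sum_le_sum fun j _ => (hr j).submodular _ _
    have h4 := Finset.sum_union_inter (s₁ := F i) (s₂ := s.biUnion F) (f := c)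
    have h5 := h (F i ∩ s.biUnion F)
    omega

/-- The covering theorem for matroids (Nash-Williams, Edmonds): if `c(F) ≤ ∑ r_i(F)` for every `F`,
then the multiset `c` is covered by sets that are independent in the respective matroids. The proof
contracts an element `e` with `c(e) > 0` in one of the matroids. This must preserve the inequalities
for one of them: otherwise each matroid has a tight set that spans `e`, the union of these sets is
tight and spans `e` in all the matroids, and the inequality fails once `e` is added to it. -/
theorem exists_covering {r : ι → Finset E → ℕ} (hr : ∀ i, IsRankFunction (r i)) [Fintype E]
    {c : E → ℕ} (h : ∀ F, ∑ e ∈ F, c e ≤ ∑ i, r i F) :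
    ∃ I : ι → Finset E, (∀ i, (I i).card ≤ r i (I i)) ∧
      ∀ e, c e ≤ (Finset.univ.filter fun i => e ∈ I i).card := by
  classical
  induction hn : ∑ e, c e generalizing r c with
  | zero =>
    refine ⟨fun _ => ∅, fun i => by simp, fun e => ?_⟩
    rw [Finset.sum_eq_zero_iff.1 hn e (Finset.mem_univ e)]
    exact Nat.zero_le _
  | succ n ih =>
    obtain ⟨e, he⟩ : ∃ e, 0 < c e := by
      by_contra! h0
      have : ∑ e, c e = 0 := Finset.sum_eq_zero fun e _ => Nat.le_zero.1 (h0 e)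
      omega
    obtain ⟨i, hie, hi⟩ : ∃ i, 0 < r i {e} ∧ ∀ F, e ∉ F →
        r i (insert e F) ≤ r i F → ∑ e ∈ F, c e < ∑ j, r j F := by
      by_contra! hcon
      choose! F heF hdep htight using hcon
      set s : Finset ι := Finset.univ.filter fun i => 0 < r i {e} with hs
      have hs' : ∀ i, i ∈ s ↔ 0 < r i {e} := fun i => by simp [hs]
      have h1 := exists_tight_biUnion hr h s F fun i hi => htight i ((hs' i).1 hi)
      have he' : e ∉ s.biUnion F := by
        simp only [Finset.mem_biUnion, not_exists, not_and]
        exact fun i hi => heF i ((hs' i).1 hi)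
      have h2 : ∀ i, r i (insert e (s.biUnion F)) ≤ r i (s.biUnion F) := by
        intro i
        by_cases hi : 0 < r i {e}
        · exact (hr i).insert_le_of_subset
            (Finset.subset_biUnion_of_mem F ((hs' i).2 hi)) (hdep i hi)
        · refine (hr i).insert_le_of_subset (Finset.empty_subset _) ?_
          rw [insert_empty_eq, (hr i).empty]
          omega
      have h3 := h (insert e (s.biUnion F))
      rw [Finset.sum_insert he'] at h3
      have h4 : ∑ i, r i (insert e (s.biUnion F)) ≤ ∑ i, r i (s.biUnion F) :=
        Finset.sum_le_sum fun i _ => h2 i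
      omega
    -- Contract `e` in the matroid `i` and decrease its multiplicity.
    set r' : ι → Finset E → ℕ := Function.update r i fun A => r i (insert e A) - 1 with hr'
    have hr'i : ∀ A, r' i A = r i (insert e A) - 1 := fun A => by simp [hr']
    have hr'j : ∀ j, j ≠ i → r' j = r j := fun j hj => by simp [hr', hj]
    set c' : E → ℕ := Function.update c e (c e - 1) with hc'
    have hc'e : c' e = c e - 1 := by simp [hc']
    have hc'f : ∀ f, f ≠ e → c' f = c f := fun f hf => by simp [hc', hf]
    have hsum : ∀ F, e ∈ F → ∑ f ∈ F, c' f + 1 = ∑ f ∈ F, c f := by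
      intro F hF
      have h1 : ∑ f ∈ F.erase e, c' f = ∑ f ∈ F.erase e, c f :=
        Finset.sum_congr rfl fun f hf => hc'f f (Finset.ne_of_mem_erase hf)
      rw [← Finset.add_sum_erase F c hF, ← Finset.add_sum_erase F c' hF, hc'e, h1]
      omega
    have hrsum : ∀ F, ∑ j, r' j F + r i F + 1 = ∑ j, r j F + r i (insert e F) := by
      intro F
      rw [← Finset.add_sum_erase Finset.univ (fun j => r j F) (Finset.mem_univ i),
        ← Finset.add_sum_erase Finset.univ (fun j => r' j F) (Finset.mem_univ i), hr'i,
        Finset.sum_congr rfl fun j hj => congrFun (hr'j j (Finset.ne_of_mem_erase hj)) F]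
      have : r i {e} ≤ r i (insert e F) :=
        (hr i).mono (Finset.singleton_subset_iff.2 (Finset.mem_insert_self e F))
      omega
    obtain ⟨I, hI, hcov⟩ := ih (r := r') (c := c') (fun j => by
        by_cases hj : j = i
        · subst hj
          have : r' j = fun A => r j (insert e A) - 1 := funext hr'i
          rw [this]
          exact (hr j).contract hie
        · rw [hr'j j hj]
          exact hr j) (fun F => by
        have h1 := hrsum F
        have h2 := h F
        by_cases heF : e ∈ F
        · have h3 := hsum F heF
          rw [Finset.insert_eq_of_mem heF] at h1
          omega
        · have h3 : ∑ f ∈ F, c' f = ∑ f ∈ F, c f :=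
            Finset.sum_congr rfl fun f hf => hc'f f (by rintro rfl; exact heF hf)
          have h4 := hi F heF
          have h5 := (hr i).mono (Finset.subset_insert e F)
          by_cases h6 : r i (insert e F) ≤ r i F
          · have := h4 h6
            omega
          · omega) (by
        have := hsum Finset.univ (Finset.mem_univ e)
        omega)
    have hIi := hI i
    rw [hr'i] at hIi
    -- `e` is a loop of the contraction, hence in no independent set of it.
    have heI : e ∉ I i := by
      intro h0
      rw [Finset.insert_eq_of_mem h0] at hIi
      have := (hr i).le_card (I i)
      have := Finset.card_pos.2 ⟨e, h0⟩
      omega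
    refine ⟨Function.update I i (insert e (I i)), fun j => ?_, fun f => ?_⟩
    · by_cases hj : j = i
      · subst hj
        rw [Function.update_self, Finset.card_insert_of_notMem heI]
        have : r j {e} ≤ r j (insert e (I j)) :=
          (hr j).mono (Finset.singleton_subset_iff.2 (Finset.mem_insert_self e _))
        omega
      · rw [Function.update_of_ne hj, ← hr'j j hj]
        exact hI j
    · by_cases hf : f = e
      · subst hf
        have h1 := hcov f
        rw [hc'e] at h1
        have h2 : (Finset.univ.filter fun j => f ∈ I j) ⊂
            Finset.univ.filter fun j => f ∈ Function.update I i (insert f (I i)) j := by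
          refine Finset.ssubset_iff.2 ⟨i, by simpa using heI, fun j hj => ?_⟩
          simp only [Finset.mem_insert, Finset.mem_filter, Finset.mem_univ, true_and] at hj ⊢
          by_cases hji : j = i
          · subst hji
            simp
          · rw [Function.update_of_ne hji]
            exact hj.resolve_left hji
        have := Finset.card_lt_card h2
        omega
      · rw [← hc'f f hf]
        refine (hcov f).trans (Finset.card_le_card fun j hj => ?_)
        simp only [Finset.mem_filter, Finset.mem_univ, true_and] at hj ⊢
        by_cases hji : j = i
        · subst hji
          simp [hj]
        · rwa [Function.update_of_ne hji]

end RankFunction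

/-! ### The cone of the points of a matroid -/

section BasisPoints

variable {E : Type*} [DecidableEq E] {r : Finset E → ℕ}

/-- The point `(1, T)` where `T` is the indicator function of the complement of `S`. -/
def basisPoint (S : Finset E) : Option E → ℤ := fun i => i.elim 1 fun e => if e ∈ S then 0 else 1

lemma sum_basisPoint (S F : Finset E) :
    ∑ e ∈ F, basisPoint S (some e) = (F.card : ℤ) - (F ∩ S).card := by
  have h1 : ∑ e ∈ F, basisPoint S (some e) = ((F \ S).card : ℤ) := by
    rw [← Finset.filter_notMem_eq_sdiff, Finset.card_filter]
    push_cast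
    refine Finset.sum_congr rfl fun e _ => ?_
    by_cases h : e ∈ S <;> simp [basisPoint, h]
  have h2 := Finset.card_sdiff_add_card_inter F S
  omega

lemma IsRankFunction.card_inter_le (hr : IsRankFunction r) {S : Finset E} (hS : S.card ≤ r S)
    (F : Finset E) : (F ∩ S).card ≤ r F := by
  have h1 := hr.submodular (F ∩ S) (S \ F)
  have h2 : F ∩ S ∪ S \ F = S := by
    rw [Finset.inter_comm, Finset.union_comm, Finset.sdiff_union_inter]
  have h3 := hr.le_card (S \ F)
  have h4 := Finset.card_sdiff_add_card_inter S F
  have h5 := hr.mono (Finset.inter_subset_left : F ∩ S ⊆ F)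
  rw [h2] at h1
  rw [Finset.inter_comm S F] at h4
  omega

/-- A sum of points `a i` to which at most as many unit vectors are added lies in every monoid that
contains all `a i` and all `a i + e_f`: each `a i` absorbs at most one of the unit vectors. -/
lemma sum_add_sum_single_mem {ι : Type*} [DecidableEq ι] {M : AddSubmonoid (Option E → ℤ)}
    {a : ι → Option E → ℤ} (h0 : ∀ i, a i ∈ M) (h1 : ∀ i f, a i + Pi.single (some f) 1 ∈ M)
    (s : Finset ι) (D : Multiset E) (hD : D.card ≤ s.card) :
    ∑ i ∈ s, a i + (D.map fun f => (Pi.single (some f) 1 : Option E → ℤ)).sum ∈ M := by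
  induction s using Finset.induction_on generalizing D with
  | empty =>
    have : D = 0 := by simpa using hD
    simp [this]
  | insert i s hi ih =>
    rw [Finset.sum_insert hi]
    rw [Finset.card_insert_of_notMem hi] at hD
    induction D using Multiset.induction_on with
    | empty => simpa [add_assoc] using M.add_mem (h0 i) (ih 0 (by simp))
    | cons f D _ =>
      have h2 := M.add_mem (h1 i f) (ih D (by simpa using hD))
      rw [Multiset.map_cons, Multiset.sum_cons]
      convert h2 using 1
      abel

variable [Fintype E]

/-- The points `(1, T)` and `(1, T + e_f)` where `T` is the indicator function of the complement of
a basis and `f` is any element. -/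
def basisPoints (r : Finset E → ℕ) : Set (Option E → ℤ) :=
  {a | ∃ S : Finset E, (S.card = r S ∧ r S = r Finset.univ) ∧
    (a = basisPoint S ∨ ∃ f, a = basisPoint S + Pi.single (some f) 1)}

/-- The functionals `T(F) - d (|F| - r(F))` for nonempty `F`, `d` and
`d (|E| - r(E) + 1) - T(E)` of the point `(d, T)`. -/
def functional (r : Finset E → ℕ) : {F : Finset E // F.Nonempty} ⊕ Bool → Option E → ℤ
  | .inl F => fun i => i.elim ((r F : ℤ) - F.1.card) fun e => if e ∈ F.1 then 1 else 0
  | .inr false => fun i => i.elim 1 0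
  | .inr true => fun i => i.elim ((Fintype.card E : ℤ) - r Finset.univ + 1) fun _ => -1

lemma functional_inl (F : {F : Finset E // F.Nonempty}) (z : Option E → ℤ) :
    functional r (.inl F) ⬝ᵥ z = ((r F : ℤ) - F.1.card) * z none + ∑ e ∈ F.1, z (some e) := by
  simp [functional, dotProduct, Fintype.sum_option, ite_mul]

lemma functional_false (z : Option E → ℤ) : functional r (.inr false) ⬝ᵥ z = z none := by
  simp [functional, dotProduct, Fintype.sum_option]

lemma functional_true (z : Option E → ℤ) : functional r (.inr true) ⬝ᵥ z =
    ((Fintype.card E : ℤ) - r Finset.univ + 1) * z none - ∑ e, z (some e) := by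
  simp [functional, dotProduct, Fintype.sum_option, sub_eq_add_neg]

lemma functional_inl_basisPoint (hr : IsRankFunction r) {S : Finset E} (hS : S.card = r S)
    (F : {F : Finset E // F.Nonempty}) : 0 ≤ functional r (.inl F) ⬝ᵥ basisPoint S := by
  have h1 : basisPoint S none = 1 := rfl
  rw [functional_inl, sum_basisPoint, h1]
  have := hr.card_inter_le hS.le F
  omega

lemma functional_true_basisPoint {S : Finset E} (hS : S.card = r S ∧ r S = r Finset.univ) :
    functional r (.inr true) ⬝ᵥ basisPoint S = 1 := by
  have h1 : basisPoint S none = 1 := rfl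
  rw [functional_true, sum_basisPoint, h1, Finset.univ_inter, Finset.card_univ]
  omega

lemma functional_inl_single (F : {F : Finset E // F.Nonempty}) (f : E) :
    functional r (.inl F) ⬝ᵥ Pi.single (some f) 1 = if f ∈ F.1 then 1 else 0 := by
  rw [dotProduct_single_one]
  rfl

lemma basisPoints_subset (hr : IsRankFunction r) :
    basisPoints r ⊆ coneSemigroup (functional r) := by
  rintro a ⟨S, hS, ha⟩ (F | _ | _)
  · have h1 := functional_inl_basisPoint hr hS.1 F
    obtain rfl | ⟨f, rfl⟩ := ha
    · exact h1
    · rw [dotProduct_add, functional_inl_single]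
      split_ifs <;> omega
  · rw [functional_false]
    obtain rfl | ⟨f, rfl⟩ := ha <;> simp [basisPoint]
  · have h1 := functional_true_basisPoint hS
    obtain rfl | ⟨f, rfl⟩ := ha
    · exact h1.symm ▸ zero_le_one
    · rw [dotProduct_add, h1, dotProduct_single_one]
      exact le_refl 0

/-- None of the functionals vanishes on all points, so that all are positive at a sum of points. -/
lemma exists_forall_functional_pos (hr : IsRankFunction r) :
    ∃ x₀, ∀ j, 0 < functional r j ⬝ᵥ x₀ := by
  obtain ⟨S, -, hS⟩ := hr.exists_basis (I := ∅) (by simp)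
  refine ⟨basisPoint S + ∑ f, (basisPoint S + Pi.single (some f) 1), fun j => ?_⟩
  have hnn : ∀ f, 0 ≤ functional r j ⬝ᵥ (basisPoint S + Pi.single (some f) 1) := fun f =>
    basisPoints_subset hr ⟨S, hS, Or.inr ⟨f, rfl⟩⟩ j
  rw [dotProduct_add, dotProduct_sum]
  rcases j with F | _ | _
  · have h1 := functional_inl_basisPoint hr hS.1 F
    obtain ⟨f, hf⟩ := F.2
    refine add_pos_of_nonneg_of_pos h1 (Finset.sum_pos' (fun f _ => hnn f)
      ⟨f, Finset.mem_univ f, ?_⟩)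
    rw [dotProduct_add, functional_inl_single, if_pos hf]
    omega
  · refine add_pos_of_pos_of_nonneg ?_ (Finset.sum_nonneg fun f _ => hnn f)
    rw [functional_false]
    exact one_pos
  · refine add_pos_of_pos_of_nonneg ?_ (Finset.sum_nonneg fun f _ => hnn f)
    rw [functional_true_basisPoint hS]
    exact one_pos

/-- The monoid generated by the points of a matroid is the set of all lattice points of a cone.
For a lattice point `(d, T)` of the cone, the covering theorem yields `d` bases such that the sum
of the indicator functions of their complements is at most `T`; the inequality for `T(E)` means that
the difference is a sum of at most `d` unit vectors. -/
lemma closure_basisPoints (hr : IsRankFunction r) :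
    AddSubmonoid.closure (basisPoints r) = coneSemigroup (functional r) := by
  apply le_antisymm
  · rw [AddSubmonoid.closure_le]
    exact basisPoints_subset hr
  intro z hz
  have hd : 0 ≤ z none := functional_false z ▸ hz (.inr false)
  obtain ⟨n, hn⟩ := Int.eq_ofNat_of_zero_le hd
  have hF : ∀ F : Finset E, (n : ℤ) * F.card ≤ n * r F + ∑ e ∈ F, z (some e) := by
    intro F
    obtain rfl | hne := F.eq_empty_or_nonempty
    · simp [hr.empty]
    · have h1 := hz (.inl ⟨F, hne⟩)
      rw [functional_inl, hn] at h1
      linarith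
  have hE := hz (.inr true)
  rw [functional_true, hn] at hE
  -- Cover each `e` by `d - T(e)` independent sets, so that at most `T(e)` sets avoid `e`.
  obtain ⟨I, hI, hcov⟩ := exists_covering (ι := Fin n) (r := fun _ => r) (fun _ => hr)
    (c := fun e => (n - z (some e)).toNat) (by
      intro F
      rw [Finset.sum_const, Finset.card_univ, Fintype.card_fin, smul_eq_mul]
      have h1 := hF (F.filter fun e => z (some e) ≤ n)
      have h2 : ((∑ e ∈ F, (n - z (some e)).toNat : ℕ) : ℤ) =
          ∑ e ∈ F.filter (fun e => z (some e) ≤ n), (n - z (some e)) := by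
        rw [Finset.sum_filter]
        push_cast
        refine Finset.sum_congr rfl fun e _ => ?_
        split_ifs <;> omega
      rw [Finset.sum_sub_distrib, Finset.sum_const, nsmul_eq_mul] at h2
      have h3 : n * r (F.filter fun e => z (some e) ≤ n) ≤ n * r F :=
        Nat.mul_le_mul_left n (hr.mono (Finset.filter_subset _ F))
      zify at h3 ⊢
      rw [← Nat.cast_sum, h2]
      linarith)
  choose S hIS hS using fun i => hr.exists_basis (hI i)
  set D : E → ℤ := fun e => z (some e) - ∑ i, basisPoint (S i) (some e) with hD
  have hD0 : ∀ e, 0 ≤ D e := by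
    intro e
    have h1 := hcov e
    have h2 : (Finset.univ.filter fun i => e ∈ I i).card ≤
        (Finset.univ.filter fun i => e ∈ S i).card :=
      Finset.card_le_card fun i hi => by
        simp only [Finset.mem_filter, Finset.mem_univ, true_and] at hi ⊢
        exact hIS i hi
    have h3 : ∑ i, basisPoint (S i) (some e) =
        (n : ℤ) - (Finset.univ.filter fun i => e ∈ S i).card := by
      have h4 := Finset.card_filter_add_card_filter_not (s := (Finset.univ : Finset (Fin n)))
        (fun i => e ∈ S i)
      have h5 : ∑ i, basisPoint (S i) (some e) =
          ((Finset.univ.filter fun i => e ∉ S i).card : ℤ) := by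
        rw [Finset.card_filter]
        push_cast
        refine Finset.sum_congr rfl fun i _ => ?_
        by_cases h : e ∈ S i <;> simp [basisPoint, h]
      rw [Finset.card_univ, Fintype.card_fin] at h4
      omega
    simp only [hD, h3]
    omega
  have hDsum : ∑ e, D e ≤ n := by
    have h1 : ∀ i, ∑ e, basisPoint (S i) (some e) = (Fintype.card E : ℤ) - r Finset.univ := by
      intro i
      rw [sum_basisPoint, Finset.univ_inter, Finset.card_univ, (hS i).1, (hS i).2]
    rw [hD, Finset.sum_sub_distrib, Finset.sum_comm, Finset.sum_congr rfl fun i _ => h1 i,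
      Finset.sum_const, Finset.card_univ, Fintype.card_fin, nsmul_eq_mul]
    linarith
  have key := sum_add_sum_single_mem (M := AddSubmonoid.closure (basisPoints r))
    (a := fun i => basisPoint (S i))
    (fun i => AddSubmonoid.subset_closure ⟨S i, hS i, Or.inl rfl⟩)
    (fun i f => AddSubmonoid.subset_closure ⟨S i, hS i, Or.inr ⟨f, rfl⟩⟩) Finset.univ
    (∑ e, (D e).toNat • {e}) (by
      rw [Multiset.card_sum, Finset.card_univ, Fintype.card_fin]
      simp only [Multiset.card_nsmul, Multiset.card_singleton, mul_one]
      zify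
      rw [Finset.sum_congr rfl fun e _ => Int.toNat_of_nonneg (hD0 e)]
      exact hDsum)
  convert key using 1
  ext i
  have hmap : ((∑ e, (D e).toNat • ({e} : Multiset E)).map
      fun f => (Pi.single (some f) 1 : Option E → ℤ)).sum =
      ∑ e, (D e).toNat • (Pi.single (some e) 1 : Option E → ℤ) := by
    rw [← Multiset.coe_mapAddMonoidHom, map_sum, ← Multiset.coe_sumAddMonoidHom, map_sum]
    simp [map_nsmul]
  rw [hmap]
  cases i with
  | none => simp [basisPoint, hn]
  | some e =>
    simp only [Pi.add_apply, Finset.sum_apply, Pi.smul_apply, Pi.single_apply, Option.some_inj]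
    simp only [smul_ite, smul_zero, Finset.sum_ite_eq, Finset.mem_univ, if_true, nsmul_eq_mul,
      mul_one, Int.toNat_of_nonneg (hD0 e)]
    simp [hD]

end BasisPoints

/-! ### Cones are saturated -/

section Saturation

variable {ι : Type*} [Fintype ι] {J : Type*}

lemma isSaturated_coneSemigroup (c : J → ι → ℤ) : IsSaturated (coneSemigroup c) := by
  intro z hz j
  have key : ∀ w ∈ PointedCone.hull ℝ
      ((fun (a : ι → ℤ) i => (a i : ℝ)) '' (coneSemigroup c : Set (ι → ℤ))),
      0 ≤ pairing (c j) w := by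
    intro w hw
    induction hw using Submodule.span_induction with
    | mem w hw =>
      obtain ⟨a, ha, rfl⟩ := hw
      have h1 := pairing_toReal (c j) a
      have h2 : (0 : ℝ) ≤ (c j ⬝ᵥ a : ℤ) := by exact_mod_cast ha j
      exact h1 ▸ h2
    | zero => rw [map_zero]
    | add w w' _ _ h h' => rw [map_add]; exact add_nonneg h h'
    | smul t w _ h =>
      have : pairing (c j) (t • w) = (t : ℝ) * pairing (c j) w :=
        (pairing (c j)).map_smul (t : ℝ) w
      rw [this]
      exact mul_nonneg t.2 h
  have h1 := key _ hz
  have h2 := pairing_toReal (c j) z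
  have h3 : (0 : ℝ) ≤ (c j ⬝ᵥ z : ℤ) := h2 ▸ h1
  exact_mod_cast h3

end Saturation

/-! ### Paths without repetitions -/

section Paths

/-- A shortest chain of related elements is free of repetitions. -/
lemma exists_injOn_chain {α : Type*} {R : α → α → Prop} {x y : α}
    (h : Relation.ReflTransGen R x y) : ∃ (n : ℕ) (v : ℕ → α), v 0 = x ∧ v n = y ∧
      (∀ i < n, R (v i) (v (i + 1))) ∧ ∀ i j, i < j → j ≤ n → v i ≠ v j := by
  classical
  have hex : ∃ (n : ℕ), ∃ v : ℕ → α, v 0 = x ∧ v n = y ∧ ∀ i < n, R (v i) (v (i + 1)) := by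
    induction h with
    | refl => exact ⟨0, fun _ => x, rfl, rfl, fun i hi => absurd hi (Nat.not_lt_zero i)⟩
    | @tail y z _ hyz ih =>
      obtain ⟨n, v, h0, hn, hv⟩ := ih
      refine ⟨n + 1, fun i => if i ≤ n then v i else z, by simp [h0], by simp, fun i hi => ?_⟩
      obtain hi' | rfl := Nat.lt_succ_iff_lt_or_eq.1 hi
      · simp only [hi'.le, if_true, Nat.succ_le_of_lt hi']
        exact hv i hi'
      · simpa [hn] using hyz
  obtain ⟨v, h0, hn, hv⟩ := Nat.find_spec hex
  refine ⟨_, v, h0, hn, hv, fun i j hij hj heq => ?_⟩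
  set n := Nat.find hex with hndef
  refine Nat.find_min hex (m := n - (j - i)) (by omega)
    ⟨fun m => if m ≤ i then v m else v (m + (j - i)), by simp [h0], ?_, fun m hm => ?_⟩
  · by_cases h1 : n - (j - i) ≤ i
    · have : n - (j - i) = i := by omega
      have h2 : j = n := by omega
      simp only [this, le_refl, if_true]
      rw [heq, h2, hn]
    · simp only [h1, if_false]
      rw [show n - (j - i) + (j - i) = n by omega, hn]
  · by_cases h1 : m + 1 ≤ i
    · simp only [h1, if_true, (Nat.le_succ m).trans h1]
      exact hv m (by omega)
    · by_cases h2 : m ≤ i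
      · obtain rfl : m = i := by omega
        simp only [le_refl, if_true, h1, if_false]
        rw [heq, show m + 1 + (j - m) = j + 1 by omega]
        exact hv j (by omega)
      · simp only [h1, h2, if_false]
        rw [show m + 1 + (j - i) = m + (j - i) + 1 by omega]
        exact hv _ (by omega)

end Paths

/-! ### The graphic matroid -/

section GraphicMatroid

variable {α β : Type*} (G : Graph α β)

/-- The subgraph with all vertices and the edges in `F`. -/
abbrev edgeSubgraph (F : Set E(G)) : Graph α β := G.restrict (Subtype.val '' F)

variable {G}

lemma edgeSubgraph_isLink {F : Set E(G)} {e : β} {x y : α} :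
    (edgeSubgraph G F).IsLink e x y ↔ ∃ he : e ∈ E(G), ⟨e, he⟩ ∈ F ∧ G.IsLink e x y := by
  simp only [edgeSubgraph, Graph.restrict_isLink, Set.mem_image, Subtype.exists, exists_and_right,
    exists_eq_right]

lemma deleteEdges_eq_edgeSubgraph (C : Set E(G)) :
    G.deleteEdges (Subtype.val '' C) = edgeSubgraph G Cᶜ := by
  rw [← Graph.restrict_edgeSet_sdiff_eq_deleteEdges, edgeSubgraph]
  congr 1
  ext e
  simp only [Set.mem_sdiff, Set.mem_image, Subtype.exists, exists_and_right, exists_eq_right,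
    Set.mem_compl_iff]
  constructor
  · rintro ⟨he, h⟩
    exact ⟨he, fun h' => h ⟨he, h'⟩⟩
  · rintro ⟨he, h⟩
    exact ⟨he, fun ⟨_, h'⟩ => h h'⟩

/-- The vector of an edge: the sum of its ends, in the vector space over the field of two
elements with basis the vertices. -/
noncomputable def edgeVector (e : E(G)) : α →₀ ZMod 2 :=
  Finsupp.single (Graph.exists_isLink_of_mem_edgeSet e.2).choose 1 +
    Finsupp.single (Graph.exists_isLink_of_mem_edgeSet e.2).choose_spec.choose 1

lemma edgeVector_eq {e : E(G)} {x y : α} (h : G.IsLink e x y) :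
    edgeVector e = Finsupp.single x 1 + Finsupp.single y 1 := by
  have key : ∀ a b, G.IsLink e a b → (Finsupp.single a 1 + Finsupp.single b 1 : α →₀ ZMod 2) =
      Finsupp.single x 1 + Finsupp.single y 1 := by
    intro a b h'
    obtain ⟨rfl, rfl⟩ | ⟨rfl, rfl⟩ := h'.eq_and_eq_or_eq_and_eq h
    · rfl
    · exact add_comm _ _
  exact key _ _ (Graph.exists_isLink_of_mem_edgeSet e.2).choose_spec.choose_spec

/-- Two vertices are joined by edges in `F` exactly if their sum is in the span of `F`. If they are
not joined, then the functional that counts the vertices joined to `x` separates their sum from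
`F`. -/
lemma single_add_single_mem_span_iff {F : Set E(G)} {x y : α} :
    Finsupp.single x 1 + Finsupp.single y 1 ∈ Submodule.span (ZMod 2) (edgeVector '' F) ↔
      Relation.ReflTransGen (edgeSubgraph G F).Adj x y := by
  classical
  constructor
  · intro h
    by_contra hxy
    let φ : (α →₀ ZMod 2) →ₗ[ZMod 2] ZMod 2 := Finsupp.linearCombination (ZMod 2)
      fun w => if Relation.ReflTransGen (edgeSubgraph G F).Adj x w then (1 : ZMod 2) else 0
    have hφ : ∀ w, φ (Finsupp.single w 1) =
        if Relation.ReflTransGen (edgeSubgraph G F).Adj x w then 1 else 0 := fun w => by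
      simp [φ]
    have hle : Submodule.span (ZMod 2) (edgeVector '' F) ≤ LinearMap.ker φ := by
      rw [Submodule.span_le]
      rintro _ ⟨e, he, rfl⟩
      obtain ⟨a, b, hab⟩ := Graph.exists_isLink_of_mem_edgeSet e.2
      have hadj : (edgeSubgraph G F).Adj a b := ⟨e, edgeSubgraph_isLink.2 ⟨e.2, he, hab⟩⟩
      rw [SetLike.mem_coe, LinearMap.mem_ker, edgeVector_eq hab, map_add, hφ, hφ]
      have hiff : Relation.ReflTransGen (edgeSubgraph G F).Adj x a ↔
          Relation.ReflTransGen (edgeSubgraph G F).Adj x b :=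
        ⟨fun h => h.tail hadj, fun h => h.tail hadj.symm⟩
      simp only [hiff]
      split_ifs
      · exact CharTwo.add_self_eq_zero 1
      · exact add_zero 0
    have h1 := hle h
    rw [LinearMap.mem_ker, map_add, hφ, hφ, if_pos .refl, if_neg hxy] at h1
    exact absurd h1 (by decide)
  · intro h
    induction h with
    | refl =>
      rw [← Finsupp.single_add, CharTwo.add_self_eq_zero, Finsupp.single_zero]
      exact Submodule.zero_mem _
    | @tail y z _ hyz ih =>
      obtain ⟨e, he⟩ := hyz
      obtain ⟨heG, heF, hlink⟩ := edgeSubgraph_isLink.1 he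
      have h1 := Submodule.add_mem _ ih
        (Submodule.subset_span (Set.mem_image_of_mem edgeVector heF))
      rw [edgeVector_eq hlink] at h1
      have h2 : (Finsupp.single y (1 : ZMod 2)) + Finsupp.single y 1 = 0 := by
        rw [← Finsupp.single_add, CharTwo.add_self_eq_zero, Finsupp.single_zero]
      convert h1 using 1
      rw [add_assoc, ← add_assoc (Finsupp.single y 1), h2, zero_add]

/-- A set of edges has a loop if and only if it is linearly dependent: the sum of the edges of a loop
is zero, and conversely the ends of an edge in the span of other edges are joined by a path of those
edges. -/
lemma hasLoop_iff {F : Set E(G)} :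
    HasLoop (edgeSubgraph G F) ↔ ¬ LinearIndepOn (ZMod 2) edgeVector F := by
  classical
  constructor
  · rintro ⟨n, v, e, hv, he, hlink⟩ hind
    choose heG heF hlinkG using fun i => edgeSubgraph_isLink.1 (hlink i)
    have hsum : ∑ i, edgeVector (⟨e i, heG i⟩ : E(G)) = 0 := by
      rw [Finset.sum_congr rfl fun i _ => edgeVector_eq (e := ⟨e i, heG i⟩) (hlinkG i),
        Finset.sum_add_distrib]
      have : ∑ i, Finsupp.single (v (i + 1)) (1 : ZMod 2) = ∑ i, Finsupp.single (v i) 1 :=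
        Equiv.sum_comp (Equiv.addRight (1 : Fin (n + 1))) fun i => Finsupp.single (v i) (1 : ZMod 2)
      rw [this, ← Finset.sum_add_distrib]
      refine Finset.sum_eq_zero fun i _ => ?_
      rw [← Finsupp.single_add, CharTwo.add_self_eq_zero, Finsupp.single_zero]
    have hinj : Function.Injective fun i => (⟨⟨e i, heG i⟩, heF i⟩ : F) := fun i j hij =>
      he (congrArg (fun f : F => (f : E(G)).1) hij)
    have h1 := hind.comp _ hinj
    have h2 := Fintype.linearIndependent_iff.1 h1 (fun _ => 1) (by simpa using hsum) 0
    exact one_ne_zero h2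
  -- Close a path of edges of `F` between the ends of a dependent edge `e₀` by the edge `e₀`.
  · intro hdep
    rw [linearIndepOn_iff_notMem_span] at hdep
    push Not at hdep
    obtain ⟨e₀, he₀, hspan⟩ := hdep
    obtain ⟨x, y, hxy⟩ := Graph.exists_isLink_of_mem_edgeSet e₀.2
    rw [edgeVector_eq hxy, single_add_single_mem_span_iff] at hspan
    obtain ⟨n, v, h0, hn, hadj, hinj⟩ := exists_injOn_chain hspan
    have : Nonempty β := ⟨e₀⟩
    choose! f hf using hadj
    have hf' : ∀ i < n, ∃ he : f i ∈ E(G), ⟨f i, he⟩ ∈ F \ {e₀} ∧ G.IsLink (f i) (v i) (v (i + 1)) :=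
      fun i hi => edgeSubgraph_isLink.1 (hf i hi)
    have hvne : ∀ i j, i ≤ n → j ≤ n → v i = v j → i = j := by
      intro i j hi hj h
      rcases lt_trichotomy i j with h' | h' | h'
      · exact absurd h (hinj i j h' hj)
      · exact h'
      · exact absurd h.symm (hinj j i h' hi)
    refine ⟨n, fun i => v i, fun i => if (i : ℕ) < n then f i else e₀, ?_, ?_, ?_⟩
    · intro i j hij
      exact Fin.ext (hvne i j (Nat.lt_succ_iff.1 i.2) (Nat.lt_succ_iff.1 j.2) hij)
    · have hne : ∀ i < n, f i ≠ e₀ := by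
        intro i hi h
        obtain ⟨he, hmem, -⟩ := hf' i hi
        exact hmem.2 (Subtype.ext h)
      have hfinj : ∀ i < n, ∀ j < n, f i = f j → i = j := by
        intro i hi j hj h
        obtain ⟨_, _, h1⟩ := hf' i hi
        obtain ⟨_, _, h2⟩ := hf' j hj
        rw [h] at h1
        obtain ⟨h3, h4⟩ | ⟨h3, h4⟩ := h1.eq_and_eq_or_eq_and_eq h2
        · exact hvne i j hi.le hj.le h3
        · have h5 := hvne i (j + 1) hi.le hj h3
          have h6 := hvne (i + 1) j hi hj.le h4
          omega
      intro i j hij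
      have hi := Nat.lt_succ_iff.1 i.2
      have hj := Nat.lt_succ_iff.1 j.2
      simp only at hij
      apply Fin.ext
      split_ifs at hij with h1 h2 h2
      · exact hfinj i h1 j h2 hij
      · exact absurd hij (hne i h1)
      · exact absurd hij.symm (hne j h2)
      · omega
    · intro i
      by_cases hi : (i : ℕ) < n
      · obtain ⟨he, hmem, hlink⟩ := hf' i hi
        have h1 : ((i + 1 : Fin (n + 1)) : ℕ) = i + 1 := by
          rw [Fin.val_add_one_of_lt (by rw [Fin.lt_def]; simpa using hi)]
        simp only [hi, if_true, h1]
        exact edgeSubgraph_isLink.2 ⟨he, hmem.1, hlink⟩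
      · have hi' : i = Fin.last n := Fin.ext (by
          have := Nat.lt_succ_iff.1 i.2
          simp only [Fin.val_last]
          omega)
        subst hi'
        simp only [Fin.val_last, lt_irrefl, if_false, Fin.last_add_one, Fin.val_zero, h0, hn]
        exact edgeSubgraph_isLink.2 ⟨e₀.2, he₀, hxy.symm⟩

/-- The edges in `F` connect a connected graph if and only if they span all edges. -/
lemma isConnected_edgeSubgraph_iff (hG : IsConnected G) {F : Set E(G)} :
    IsConnected (edgeSubgraph G F) ↔
      Submodule.span (ZMod 2) (edgeVector '' F) =
        Submodule.span (ZMod 2) (Set.range (edgeVector (G := G))) := by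
  constructor
  · intro h
    refine le_antisymm (Submodule.span_mono (Set.image_subset_range _ _)) ?_
    rw [Submodule.span_le]
    rintro _ ⟨e, rfl⟩
    obtain ⟨x, y, hxy⟩ := Graph.exists_isLink_of_mem_edgeSet e.2
    rw [edgeVector_eq hxy, SetLike.mem_coe, single_add_single_mem_span_iff]
    exact h.2 x hxy.left_mem y hxy.right_mem
  · intro h
    refine ⟨hG.1, fun x hx y hy => ?_⟩
    rw [← single_add_single_mem_span_iff, h, ← Set.image_univ, single_add_single_mem_span_iff]
    have : edgeSubgraph G Set.univ = G := by
      rw [edgeSubgraph, Set.image_univ, Subtype.range_coe, Graph.restrict_self]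
    rw [this]
    exact hG.2 x hx y hy

end GraphicMatroid

/-! ### Spanning trees and cuts -/

section GraphRank

variable {α β : Type*} (G : Graph α β)

/-- The rank of a set of edges in the graphic matroid, represented over the field of two elements
by `edgeVector`. -/
noncomputable def graphRank (F : Finset E(G)) : ℕ :=
  Module.finrank (ZMod 2) (Submodule.span (ZMod 2) (edgeVector '' (F : Set E(G))))

lemma finiteDimensional_span (F : Finset E(G)) :
    FiniteDimensional (ZMod 2) (Submodule.span (ZMod 2) (edgeVector '' (F : Set E(G)))) :=
  FiniteDimensional.span_of_finite _ (F.finite_toSet.image _)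

lemma isRankFunction_graphRank [DecidableEq E(G)] : IsRankFunction (graphRank G) := by
  have hfin := finiteDimensional_span G
  refine ⟨by simp [graphRank], fun {A B} h => ?_, fun e A => ?_, fun A B => ?_⟩
  · exact Submodule.finrank_mono (Submodule.span_mono (Set.image_mono (by exact_mod_cast h)))
  · have h1 := Submodule.finrank_add_le_finrank_add_finrank
      (Submodule.span (ZMod 2) {edgeVector e})
      (Submodule.span (ZMod 2) (edgeVector '' (A : Set E(G))))
    have h2 := finrank_span_le_card (R := ZMod 2) ({edgeVector e} : Set (α →₀ ZMod 2))
    rw [← Submodule.span_union, Set.singleton_union] at h1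
    rw [Set.toFinset_singleton, Finset.card_singleton] at h2
    rw [graphRank, graphRank, Finset.coe_insert, Set.image_insert_eq]
    omega
  · have h1 := Submodule.finrank_sup_add_finrank_inf_eq
      (Submodule.span (ZMod 2) (edgeVector '' (A : Set E(G))))
      (Submodule.span (ZMod 2) (edgeVector '' (B : Set E(G))))
    have h2 : Submodule.span (ZMod 2) (edgeVector '' ((A ∩ B : Finset E(G)) : Set E(G))) ≤
        Submodule.span (ZMod 2) (edgeVector '' (A : Set E(G))) ⊓
          Submodule.span (ZMod 2) (edgeVector '' (B : Set E(G))) := by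
      rw [Finset.coe_inter]
      exact le_inf (Submodule.span_mono (Set.image_mono Set.inter_subset_left))
        (Submodule.span_mono (Set.image_mono Set.inter_subset_right))
    have h3 := Submodule.finrank_mono h2
    rw [← Submodule.span_union, ← Set.image_union, ← Finset.coe_union] at h1
    simp only [graphRank]
    omega

variable {G}

lemma linearIndepOn_iff_card_eq_graphRank {F : Finset E(G)} :
    LinearIndepOn (ZMod 2) edgeVector (F : Set E(G)) ↔ F.card = graphRank G F := by
  rw [LinearIndepOn, linearIndependent_iff_card_eq_finrank_span, Set.finrank, graphRank,
    Set.image_eq_range]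
  simp

variable [Fintype E(G)]

lemma isConnected_iff_graphRank_eq (hG : IsConnected G) {F : Finset E(G)} :
    IsConnected (edgeSubgraph G F) ↔ graphRank G F = graphRank G Finset.univ := by
  have hfin := finiteDimensional_span G
  rw [isConnected_edgeSubgraph_iff hG, graphRank, graphRank, ← Set.image_univ, ← Finset.coe_univ]
  exact ⟨fun h => by rw [h], fun h => Submodule.eq_of_le_of_finrank_eq
    (Submodule.span_mono (Set.image_mono (by simp))) h⟩

/-- The spanning trees are the bases of the graphic matroid. -/
lemma isSpanningTree_iff (hG : IsConnected G) {S : Finset E(G)} :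
    IsSpanningTree G S ↔ S.card = graphRank G S ∧ graphRank G S = graphRank G Finset.univ := by
  rw [IsSpanningTree, and_comm]
  refine and_congr ?_ (isConnected_iff_graphRank_eq hG)
  change ¬ HasLoop (edgeSubgraph G S) ↔ _
  rw [hasLoop_iff, not_not, linearIndepOn_iff_card_eq_graphRank]

/-- Every cut is obtained from the complement of a spanning tree by adding one of the edges of the
tree. Otherwise each of its edges would create a loop, hence be in the span of the remaining edges,
and these would already connect the graph. -/
lemma IsCut.exists_isSpanningTree [DecidableEq E(G)] (hG : IsConnected G) {C : Finset E(G)}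
    (hC : IsCut G C) : ∃ f ∈ C, IsSpanningTree G (insert f Cᶜ) := by
  obtain ⟨⟨hconn, hloop⟩, hadd⟩ := hC
  rw [deleteEdges_eq_edgeSubgraph] at hconn hloop
  rw [hasLoop_iff, not_not] at hloop
  by_contra! hcon
  apply hconn
  rw [isConnected_edgeSubgraph_iff hG]
  refine le_antisymm (Submodule.span_mono (Set.image_subset_range _ _)) ?_
  rw [Submodule.span_le]
  rintro _ ⟨e, rfl⟩
  by_cases he : e ∈ C
  · have h1 := hadd e he
    have h2 : ((C : Set E(G)) \ {e})ᶜ = insert e (C : Set E(G))ᶜ := by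
      ext x
      simp only [Set.mem_compl_iff, Set.mem_sdiff, Set.mem_singleton_iff, Set.mem_insert_iff]
      tauto
    have h3 : ((insert e Cᶜ : Finset E(G)) : Set E(G)) = insert e (C : Set E(G))ᶜ := by simp
    rw [deleteEdges_eq_edgeSubgraph, h2] at h1
    have h4 := hcon e he
    rw [IsSpanningTree, h3] at h4
    have h5 : HasLoop (edgeSubgraph G (insert e (C : Set E(G))ᶜ)) := by
      by_contra h
      exact h4 ⟨h1.resolve_left h, h⟩
    rw [hasLoop_iff, linearIndepOn_insert (by simpa using he)] at h5
    by_contra h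
    exact h5 ⟨hloop, h⟩
  · exact Submodule.subset_span (Set.mem_image_of_mem _ he)

end GraphRank

/-! ### Square-free monomials -/

section Monomials

variable {E : Type*}

/-- The exponent of the monomial `∏ e ∈ A, t_e`. -/
noncomputable def indicatorExponent (A : Finset E) : E →₀ ℕ := ∑ e ∈ A, Finsupp.single e 1

lemma prod_X_eq_monomial {R : Type*} [CommSemiring R] (A : Finset E) :
    ∏ e ∈ A, MvPolynomial.X (R := R) e = MvPolynomial.monomial (indicatorExponent A) 1 := by
  rw [indicatorExponent, MvPolynomial.monomial_sum_one]
  rfl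

variable [DecidableEq E]

lemma indicatorExponent_apply (A : Finset E) (e : E) :
    indicatorExponent A e = if e ∈ A then 1 else 0 := by
  simp [indicatorExponent, Finsupp.finsetSum_apply, Finsupp.single_apply]

lemma mem_support_sum_monomial_one {R ι : Type*} [CommSemiring R] [CharZero R] (s : Finset ι)
    (x : ι → E →₀ ℕ) (T : E →₀ ℕ) :
    T ∈ (∑ i ∈ s, MvPolynomial.monomial (x i) (1 : R)).support ↔ ∃ i ∈ s, x i = T := by
  classical
  rw [MvPolynomial.mem_support_iff, MvPolynomial.coeff_sum]
  simp only [MvPolynomial.coeff_monomial, ← Finset.sum_filter, Finset.sum_const, nsmul_eq_mul,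
    mul_one, Nat.cast_ne_zero, Finset.card_ne_zero, Finset.Nonempty, Finset.mem_filter]

lemma latticePoint_compl [Fintype E] (S : Finset E) :
    latticePoint (indicatorExponent Sᶜ) = basisPoint S := by
  funext i
  cases i with
  | none => rfl
  | some e =>
    by_cases h : e ∈ S <;> simp [latticePoint, basisPoint, indicatorExponent_apply, h]

lemma latticePoint_add_single (T : E →₀ ℕ) (f : E) :
    latticePoint (T + Finsupp.single f 1) = latticePoint T + Pi.single (some f) 1 := by
  funext i
  cases i with
  | none => simp [latticePoint]
  | some e => simp [latticePoint, Finsupp.single_apply, Pi.single_apply, eq_comm]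

end Monomials

/-! ### The exponents of the Symanzik polynomials -/

section PointSet

variable {α β : Type*} {G : Graph α β} [Fintype E(G)]

open scoped Classical in
lemma firstSymanzik_eq : firstSymanzik G =
    ∑ S ∈ spanningTrees G, MvPolynomial.monomial (indicatorExponent Sᶜ) 1 := by
  rw [firstSymanzik]
  exact Finset.sum_congr rfl fun S _ => prod_X_eq_monomial _

open scoped Classical in
lemma mem_support_firstSymanzik {T : E(G) →₀ ℕ} :
    T ∈ (firstSymanzik G).support ↔ ∃ S, IsSpanningTree G S ∧ indicatorExponent Sᶜ = T := by
  rw [firstSymanzik_eq, mem_support_sum_monomial_one]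
  simp [spanningTrees]

open scoped Classical in
/-- The mass terms do not cancel: their coefficients become positive integers once the momenta are
set to `0` and the masses to `1`. -/
lemma add_single_mem_support_secondSymanzik {S : Finset E(G)} (hS : IsSpanningTree G S) (f : E(G)) :
    indicatorExponent Sᶜ + Finsupp.single f 1 ∈ (secondSymanzik G).support := by
  let φ : Coeff G →+* ℤ := MvPolynomial.eval (Sum.elim 0 1)
  have h1 : MvPolynomial.map φ (secondSymanzik G) =
      ∑ p ∈ Finset.univ ×ˢ spanningTrees G,
        MvPolynomial.monomial (indicatorExponent p.2ᶜ + Finsupp.single p.1 1) 1 := by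
    rw [secondSymanzik, firstSymanzik_eq, Finset.sum_product, map_add, map_mul, map_sum, map_sum,
      map_sum, Finset.sum_eq_zero, zero_add, Finset.sum_mul_sum]
    · refine Finset.sum_congr rfl fun e _ => Finset.sum_congr rfl fun S _ => ?_
      simp only [map_mul, MvPolynomial.map_C, MvPolynomial.map_X, MvPolynomial.map_monomial,
        map_one, map_pow]
      have : φ (massVar G e) = 1 := by simp [φ, massVar]
      rw [this, MvPolynomial.C_1, one_pow, one_mul, MvPolynomial.X, MvPolynomial.monomial_mul,
        one_mul, add_comm]
    · intro C _
      have : φ (momentumVar G C) = 0 := by simp [φ, momentumVar]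
      rw [map_mul, MvPolynomial.map_C, this, MvPolynomial.C_0, zero_mul]
  have h2 : indicatorExponent Sᶜ + Finsupp.single f 1 ∈
      (MvPolynomial.map φ (secondSymanzik G)).support := by
    rw [h1, mem_support_sum_monomial_one]
    exact ⟨(f, S), by simpa [spanningTrees] using hS, rfl⟩
  exact MvPolynomial.support_map_subset _ _ h2

open scoped Classical in
lemma exists_of_mem_support_secondSymanzik (hG : IsConnected G) {T : E(G) →₀ ℕ}
    (hT : T ∈ (secondSymanzik G).support) :
    ∃ S, IsSpanningTree G S ∧ ∃ f, T = indicatorExponent Sᶜ + Finsupp.single f 1 := by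
  rw [secondSymanzik] at hT
  obtain hT | hT := Finset.mem_union.1 (MvPolynomial.support_add hT)
  · obtain ⟨C, hC, hT⟩ := Finset.mem_biUnion.1 (MvPolynomial.support_sum hT)
    rw [prod_X_eq_monomial, MvPolynomial.C_mul_monomial] at hT
    obtain rfl := Finset.mem_singleton.1 (MvPolynomial.support_monomial_subset hT)
    obtain ⟨f, hf, hS⟩ := IsCut.exists_isSpanningTree hG (by simpa [cuts] using hC)
    refine ⟨_, hS, f, ?_⟩
    ext e
    by_cases he : e = f
    · subst he
      simp [indicatorExponent_apply, hf]
    · simp [indicatorExponent_apply, he]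
  · obtain ⟨a, ha, b, hb, rfl⟩ := Finset.mem_add.1 (MvPolynomial.support_mul _ _ hT)
    obtain ⟨e, -, ha⟩ := Finset.mem_biUnion.1 (MvPolynomial.support_sum ha)
    rw [MvPolynomial.X, MvPolynomial.C_mul_monomial] at ha
    obtain rfl := Finset.mem_singleton.1 (MvPolynomial.support_monomial_subset ha)
    obtain ⟨S, hS, rfl⟩ := mem_support_firstSymanzik.1 hb
    exact ⟨S, hS, e, add_comm _ _⟩

open scoped Classical in
/-- The monomials of `Ψ` are the complements of the bases, and those of `Q` are the products of one of
these with a variable: the mass terms provide all such products, and the cuts no others. -/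
lemma pointSet_eq_basisPoints (hG : IsConnected G) : pointSet G = basisPoints (graphRank G) := by
  ext a
  simp only [pointSet, basisPoints, Set.mem_ofPred_eq, ← isSpanningTree_iff hG]
  constructor
  · rintro ⟨T, hT | hT, rfl⟩
    · obtain ⟨S, hS, rfl⟩ := mem_support_firstSymanzik.1 hT
      exact ⟨S, hS, Or.inl (latticePoint_compl S)⟩
    · obtain ⟨S, hS, f, rfl⟩ := exists_of_mem_support_secondSymanzik hG hT
      exact ⟨S, hS, Or.inr ⟨f, by rw [latticePoint_add_single, latticePoint_compl]⟩⟩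
  · rintro ⟨S, hS, rfl | ⟨f, rfl⟩⟩
    · exact ⟨_, Or.inl (mem_support_firstSymanzik.2 ⟨S, hS, rfl⟩), (latticePoint_compl S).symm⟩
    · exact ⟨_, Or.inr (add_single_mem_support_secondSymanzik hS f), by
        rw [latticePoint_add_single, latticePoint_compl]⟩

lemma finite_pointSet : (pointSet G).Finite := by
  classical
  refine Set.Finite.subset
    (((firstSymanzik G).support ∪ (secondSymanzik G).support).finite_toSet.image latticePoint) ?_
  rintro _ ⟨T, hT, rfl⟩
  exact ⟨T, Finset.mem_union.2 hT, rfl⟩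

open scoped Classical in
lemma semigroup_eq_coneSemigroup (hG : IsConnected G) :
    semigroup G = coneSemigroup (functional (graphRank G)) := by
  rw [semigroup, pointSet_eq_basisPoints hG, closure_basisPoints (isRankFunction_graphRank G)]

end PointSet

end Feynman

theorem mainTheorem12 {α β : Type*} (G : Graph α β) [Finite V(G)] [Fintype E(G)]
    (hG : Feynman.IsConnected G) :
    Feynman.IsSaturated (Feynman.semigroup G) ∧
    ∀ (k : Type*) [Field k],
      (IsDomain (AddMonoidAlgebra k (Feynman.semigroup G)) ∧
        IsIntegrallyClosed (AddMonoidAlgebra k (Feynman.semigroup G))) ∧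
      Feynman.IsCohenMacaulayRing
        (MvPolynomial (Feynman.pointSet G) k ⧸ Feynman.toricIdeal k (Feynman.pointSet G)) := by
  classical
  have hcone := Feynman.semigroup_eq_coneSemigroup hG
  refine ⟨?_, fun k _ => ⟨Feynman.isDomain_and_isIntegrallyClosed k hcone, ?_⟩⟩
  · rw [hcone]
    exact Feynman.isSaturated_coneSemigroup _
  · obtain ⟨x₀, hx₀⟩ := Feynman.exists_forall_functional_pos (Feynman.isRankFunction_graphRank G)
    exact Feynman.isCohenMacaulayRing_quotient_toricIdeal k Feynman.finite_pointSet hcone x₀ hx₀
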